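/- Let $K$ be a field of characteristic different from $2$, $3$ and $7$. For $s\in K$ put \begin{align*} c_4 &= -31\left(s^4 + 42 s^2 - 147\right) + \tfrac{32200}{3}\, s,\\ c_2 &= 2^8 \left(s^8 + 84 s^6 - \tfrac{3472}{3} s^5 + 1470 s^4 - 48608 s^3 + 53508 s^2 + 170128 s + 21609\right),\\ c_0 &= \tfrac{2^{20}\cdot 7}{3}\, s\, (s^2 + 7)^3 (s^2 + 63),\\ d &= s^4 + 42 s^2 + \tfrac{1736}{3}\, s - 147, \end{align*} and suppose that $c_0 d\neq 0$. Let $C_{24}^s$ be the genus-$2$ curve over $K$ given by \[ d\,y^2 = x^6 + c_4 x^4 + c_2 x^2 + c_0 . \] Let $D$ be the elliptic curve $y^2 = x^3 + 14x^2 + 196x$ over $K$, and suppose that there is a nonzero point $(z,w)\in D(K)$ such that \[ s = -21\ \frac{(z^2 + 196)(z^2 + 56 z + 196) + 32 (z + 14)(z - 14) w}{z^4 - 896 z^3 - 24696 z^2 - 175616 z + 38416}, \] the denominator being nonzero. Then there is a $K$-rational point of order $48$ on the Jacobian of $C_{24}^s$. -/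

import Mathlib

open Polynomial
open scoped WithZero

noncomputable section

/-! ### Places, divisors and the Picard group of a function field of one variable -/

/-- A place of a function field `F` of one variable over `k`: a normalised discrete valuation
`F → ℤ ∪ {∞}` (written multiplicatively) which is trivial on `k`. When `F` is the function field
of a complete regular curve `C` over `k`, the places are the closed points of `C`. -/
@[ext]
structure Place (k F : Type*) [Field k] [Field F] [Algebra k F] where
  /-- the valuation -/
  v : Valuation F ℤᵐ⁰
  surjective : Function.Surjective v
  trivial_on : ∀ c : k, c ≠ 0 → v (algebraMap k F c) = 1

namespace Place

variable {k F : Type*} [Field k] [Field F] [Algebra k F]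

/-- The order of vanishing of `g` at the place `P`
(the usual one for `g ≠ 0`; the value at `g = 0` is never used). -/
def ord (P : Place k F) (g : F) : ℤ := -WithZero.log (P.v g)

lemma ord_one (P : Place k F) : P.ord 1 = 0 := by simp [ord]

lemma ord_mul (P : Place k F) {g h : F} (hg : g ≠ 0) (hh : h ≠ 0) :
    P.ord (g * h) = P.ord g + P.ord h := by
  have h1 : P.v g ≠ 0 := (Valuation.ne_zero_iff _).2 hg
  have h2 : P.v h ≠ 0 := (Valuation.ne_zero_iff _).2 hh
  simp only [ord, map_mul, WithZero.log_mul h1 h2]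
  ring

lemma ord_inv (P : Place k F) (g : F) : P.ord g⁻¹ = -P.ord g := by
  simp [ord]

lemma v_algebraMap_le_one (P : Place k F) (c : k) : P.v (algebraMap k F c) ≤ 1 := by
  by_cases hc : c = 0
  · simp [hc]
  · exact (P.trivial_on c hc).le

/-- The valuation ring `{g | ord_P g ≥ 0}`, as a `k`-subspace of `F`. -/
def valuationRing (P : Place k F) : Submodule k F where
  carrier := {g | P.v g ≤ 1}
  zero_mem' := by simp
  add_mem' := fun ha hb => (P.v.map_add _ _).trans (max_le ha hb)
  smul_mem' := fun c g hg => by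
    simp only [Set.mem_ofPred_eq, Algebra.smul_def, map_mul] at hg ⊢
    exact mul_le_one' (P.v_algebraMap_le_one c) hg

/-- The maximal ideal `{g | ord_P g > 0}` of the valuation ring, as a `k`-subspace of `F`. -/
def maximalIdeal (P : Place k F) : Submodule k F where
  carrier := {g | P.v g < 1}
  zero_mem' := by simp
  add_mem' := fun ha hb => (P.v.map_add _ _).trans_lt (max_lt ha hb)
  smul_mem' := fun c g hg => by
    simp only [Set.mem_ofPred_eq, Algebra.smul_def, map_mul] at hg ⊢
    exact (mul_le_of_le_one_left' (P.v_algebraMap_le_one c)).trans_lt hg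

/-- The degree of a place: the dimension over `k` of its residue field. -/
def degree (P : Place k F) : ℤ :=
  Module.finrank k (P.valuationRing ⧸ P.maximalIdeal.submoduleOf P.valuationRing)

/-- The image of a place under an automorphism `τ` of `F` that restricts to an automorphism `σ`
of `k`. -/
def map (σ : k ≃+* k) (τ : F ≃+* F) (h : ∀ c, τ (algebraMap k F c) = algebraMap k F (σ c))
    (P : Place k F) : Place k F where
  v := P.v.comap (τ.symm : F →+* F)
  surjective := fun a => by
    obtain ⟨g, hg⟩ := P.surjective a
    exact ⟨τ g, by simpa using hg⟩
  trivial_on := fun c hc => by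
    have h' : τ.symm (algebraMap k F c) = algebraMap k F (σ.symm c) := by
      rw [RingEquiv.symm_apply_eq, h, RingEquiv.apply_symm_apply]
    have := P.trivial_on (σ.symm c) (by simpa using hc)
    simpa [h'] using this

lemma map_injective (σ : k ≃+* k) (τ : F ≃+* F)
    (h : ∀ c, τ (algebraMap k F c) = algebraMap k F (σ c)) :
    Function.Injective (map σ τ h) := by
  intro P Q hPQ
  ext g
  have := congrArg (fun R : Place k F => R.v (τ g)) hPQ
  simpa [map] using this

lemma map_surjective (σ : k ≃+* k) (τ : F ≃+* F)
    (h : ∀ c, τ (algebraMap k F c) = algebraMap k F (σ c)) :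
    Function.Surjective (map σ τ h) := by
  intro P
  refine ⟨map σ.symm τ.symm (fun c => ?_) P, ?_⟩
  · rw [RingEquiv.symm_apply_eq, h, RingEquiv.apply_symm_apply]
  · ext g
    simp [map]

lemma ord_map (σ : k ≃+* k) (τ : F ≃+* F)
    (h : ∀ c, τ (algebraMap k F c) = algebraMap k F (σ c)) (P : Place k F) (g : F) :
    (map σ τ h P).ord (τ g) = P.ord g := by
  simp [map, ord]

end Place

section Divisors

variable (k F : Type*) [Field k] [Field F] [Algebra k F]

/-- Divisors: finite formal `ℤ`-linear combinations of places. -/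
abbrev Divisor : Type _ := Place k F →₀ ℤ

/-- The degree `∑ n_P P ↦ ∑ n_P deg P` of a divisor. -/
def Divisor.degree : Divisor k F →+ ℤ :=
  Finsupp.liftAddHom fun P => AddMonoidHom.mulRight P.degree

/-- The group of principal divisors `div g = ∑ ord_P(g) P`, for `g ≠ 0` in `F`. -/
def principalDivisors : AddSubgroup (Divisor k F) where
  carrier := {D | ∃ g : F, g ≠ 0 ∧ ∀ P : Place k F, D P = P.ord g}
  zero_mem' := ⟨1, one_ne_zero, fun P => by simp [P.ord_one]⟩
  add_mem' := by
    rintro D E ⟨g, hg, hD⟩ ⟨h, hh, hE⟩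
    exact ⟨g * h, mul_ne_zero hg hh, fun P => by
      rw [Finsupp.add_apply, hD, hE, P.ord_mul hg hh]⟩
  neg_mem' := by
    rintro D ⟨g, hg, hD⟩
    exact ⟨g⁻¹, inv_ne_zero hg, fun P => by rw [Finsupp.neg_apply, hD, P.ord_inv]⟩

/-- The group of divisor classes. -/
abbrev Pic : Type _ := Divisor k F ⧸ principalDivisors k F

/-- The group of divisor classes of degree zero. -/
def Pic0 : AddSubgroup (Pic k F) :=
  (Divisor.degree k F).ker.map (QuotientAddGroup.mk' (principalDivisors k F))

variable {k F}

/-- The action on divisor classes of an automorphism `τ` of `F` that restricts to an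
automorphism `σ` of `k`. -/
def Pic.map (σ : k ≃+* k) (τ : F ≃+* F)
    (h : ∀ c, τ (algebraMap k F c) = algebraMap k F (σ c)) : Pic k F →+ Pic k F :=
  QuotientAddGroup.map _ _ (Finsupp.mapDomain.addMonoidHom (Place.map σ τ h)) (by
    rintro D ⟨g, hg, hD⟩
    refine ⟨τ g, by simpa using hg, fun P => ?_⟩
    obtain ⟨Q, rfl⟩ := Place.map_surjective σ τ h P
    rw [Place.ord_map, ← hD]
    exact Finsupp.mapDomain_apply (Place.map_injective σ τ h) D Q)

end Divisors

/-! ### Curves of genus two and their Jacobians -/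

/-- The data of a genus-`2` curve `d y² = f(x)` over a field of characteristic different from `2`,
with `d ≠ 0` and `f` a separable polynomial of degree `6`. -/
structure SexticCurve (K : Type*) [Field K] where
  d : K
  f : K[X]
  two_ne : (2 : K) ≠ 0
  d_ne : d ≠ 0
  natDegree_f : f.natDegree = 6
  separable_f : f.Separable

namespace SexticCurve

section

variable {K : Type*} [Field K] (C : SexticCurve K)

/-- The base change of a curve to an extension field. -/
def baseChange (L : Type*) [Field L] [Algebra K L] : SexticCurve L where
  d := algebraMap K L C.d
  f := C.f.map (algebraMap K L)
  two_ne := by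
    rw [← map_ofNat (algebraMap K L) 2]
    exact (map_ne_zero (algebraMap K L)).2 C.two_ne
  d_ne := (map_ne_zero (algebraMap K L)).2 C.d_ne
  natDegree_f := by rw [natDegree_map, C.natDegree_f]
  separable_f := C.separable_f.map

/-- The polynomial `Y² - f(X) / d` in `K[X][Y]`. -/
def polynomial : K[X][X] := X ^ 2 - Polynomial.C (Polynomial.C C.d⁻¹ * C.f)

lemma irreducible_polynomial : Irreducible C.polynomial := by
  have hm : C.polynomial.Monic := monic_X_pow_sub_C _ two_ne_zero
  have hd : C.polynomial.natDegree = 2 := natDegree_X_pow_sub_C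
  by_contra h
  obtain ⟨a, b, h0, h1⟩ := (hm.not_irreducible_iff_exists_add_mul_eq_coeff hd).1 h
  have e0 : C.polynomial.coeff 0 = -(Polynomial.C C.d⁻¹ * C.f) := by
    simp [polynomial]
  have e1 : C.polynomial.coeff 1 = 0 := by
    simp [polynomial, coeff_X_pow]
  rw [e0] at h0
  rw [e1] at h1
  have hdd : Polynomial.C C.d * Polynomial.C C.d⁻¹ = 1 := by
    rw [← Polynomial.C_mul, mul_inv_cancel₀ C.d_ne, Polynomial.C_1]
  have hf : C.f = Polynomial.C C.d * (a * a) := by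
    linear_combination (-C.f) * hdd + Polynomial.C C.d * a * h1 - Polynomial.C C.d * h0
  have hu : IsUnit a := by
    refine C.separable_f.squarefree a ⟨Polynomial.C C.d, ?_⟩
    rw [hf]; ring
  have h6 := C.natDegree_f
  rw [hf, natDegree_C_mul C.d_ne, natDegree_mul hu.ne_zero hu.ne_zero,
    natDegree_eq_zero_of_isUnit hu] at h6
  omega

/-- The coordinate ring `K[x, y] / (d y² - f(x))` of the affine curve. -/
abbrev CoordinateRing : Type _ := AdjoinRoot C.polynomial

instance : IsDomain C.CoordinateRing :=
  AdjoinRoot.isDomain_of_prime C.irreducible_polynomial.prime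

/-- The function field of the curve. -/
abbrev FunctionField : Type _ := FractionRing C.CoordinateRing

variable {L : Type*} [Field L] [Algebra K L]

lemma map_polynomial_baseChange (σ : L ≃ₐ[K] L) :
    (C.baseChange L).polynomial.map (mapRingHom (σ : L →+* L)) = (C.baseChange L).polynomial := by
  have h : ((σ : L →+* L)).comp (algebraMap K L) = algebraMap K L :=
    RingHom.ext fun c => by simp
  simp [polynomial, baseChange, Polynomial.map_map, h]

/-- The ring endomorphism of `L[x, y] / (d y² - f(x))` that fixes `x` and `y` and acts as `σ`
on `L`. -/
def galoisHom (σ : L ≃ₐ[K] L) :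
    (C.baseChange L).CoordinateRing →+* (C.baseChange L).CoordinateRing :=
  AdjoinRoot.lift ((AdjoinRoot.of _).comp (mapRingHom (σ : L →+* L))) (AdjoinRoot.root _) (by
    rw [← eval₂_map, C.map_polynomial_baseChange σ, AdjoinRoot.eval₂_root])

lemma galoisHom_comp_symm (σ : L ≃ₐ[K] L) :
    (C.galoisHom σ).comp (C.galoisHom σ.symm) = RingHom.id _ := by
  have h : ((σ : L →+* L)).comp (σ.symm : L →+* L) = RingHom.id L :=
    RingHom.ext fun c => by simp
  refine AdjoinRoot.ringHom_ext (RingHom.ext fun p => ?_) ?_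
  · simp [galoisHom, Polynomial.map_map, h]
  · simp [galoisHom]

/-- The automorphism of `L[x, y] / (d y² - f(x))` that fixes `x` and `y` and acts as `σ` on `L`. -/
def galoisEquiv (σ : L ≃ₐ[K] L) :
    (C.baseChange L).CoordinateRing ≃+* (C.baseChange L).CoordinateRing :=
  RingEquiv.ofRingHom (C.galoisHom σ) (C.galoisHom σ.symm) (C.galoisHom_comp_symm σ)
    (C.galoisHom_comp_symm σ.symm)

/-- The automorphism of the function field of the base change to `L` that fixes `x` and `y` and
acts as `σ` on `L`. -/
def galoisAut (σ : L ≃ₐ[K] L) :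
    (C.baseChange L).FunctionField ≃+* (C.baseChange L).FunctionField :=
  IsFractionRing.ringEquivOfRingEquiv (C.galoisEquiv σ)

lemma galoisAut_algebraMap (σ : L ≃ₐ[K] L) (c : L) :
    C.galoisAut σ (algebraMap L _ c) = algebraMap L _ (σ c) := by
  rw [IsScalarTower.algebraMap_apply L (C.baseChange L).CoordinateRing
      (C.baseChange L).FunctionField c,
    IsScalarTower.algebraMap_apply L (C.baseChange L).CoordinateRing
      (C.baseChange L).FunctionField (σ c), galoisAut,
    IsFractionRing.ringEquivOfRingEquiv_algebraMap]
  congr 1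
  rw [IsScalarTower.algebraMap_apply L L[X] (C.baseChange L).CoordinateRing c,
    IsScalarTower.algebraMap_apply L L[X] (C.baseChange L).CoordinateRing (σ c)]
  simp [galoisEquiv, galoisHom, AdjoinRoot.algebraMap_eq]

/-- The action of `σ` on the divisor classes of the base change to `L`. -/
def galoisPic (σ : L ≃ₐ[K] L) :
    Pic L (C.baseChange L).FunctionField →+ Pic L (C.baseChange L).FunctionField :=
  Pic.map (σ : L ≃+* L) (C.galoisAut σ) (C.galoisAut_algebraMap σ)

/-- The group `J(K)` of `K`-rational points of the Jacobian `J` of the curve: the divisor classes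
of degree zero on the curve over a separable closure of `K` that are fixed by the absolute
Galois group of `K`. -/
def jacobianPoints :
    AddSubgroup (Pic (SeparableClosure K) (C.baseChange (SeparableClosure K)).FunctionField) where
  carrier := {c | c ∈ Pic0 _ _ ∧ ∀ σ : SeparableClosure K ≃ₐ[K] SeparableClosure K,
    C.galoisPic σ c = c}
  zero_mem' := ⟨zero_mem _, fun σ => map_zero _⟩
  add_mem' := fun ha hb => ⟨add_mem ha.1 hb.1, fun σ => by rw [map_add, ha.2, hb.2]⟩
  neg_mem' := fun ha => ⟨neg_mem ha.1, fun σ => by rw [map_neg, ha.2]⟩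

end

end SexticCurve

/-! ### The family of curves -/

namespace C24

variable {K : Type*} [Field K] (s : K)

/-- The coefficient `c₄ = -31 (s⁴ + 42 s² - (32200/93) s - 147)`; the factor `31` is multiplied
into the linear term, so that only `3` has to be invertible. -/
def c₄ : K := -31 * (s ^ 4 + 42 * s ^ 2 - 147) + 32200 / 3 * s

def c₂ : K :=
  2 ^ 8 * (s ^ 8 + 84 * s ^ 6 - 3472 / 3 * s ^ 5 + 1470 * s ^ 4 - 48608 * s ^ 3 + 53508 * s ^ 2
    + 170128 * s + 21609)

def c₀ : K := 2 ^ 20 * 7 / 3 * s * (s ^ 2 + 7) ^ 3 * (s ^ 2 + 63)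

def d : K := s ^ 4 + 42 * s ^ 2 + 1736 / 3 * s - 147

/-- The sextic `x⁶ + c₄ x⁴ + c₂ x² + c₀`. -/
def sextic : K[X] := X ^ 6 + C (c₄ s) * X ^ 4 + C (c₂ s) * X ^ 2 + C (c₀ s)

lemma natDegree_sextic : (sextic s).natDegree = 6 := by
  unfold sextic
  compute_degree!

lemma discr_eq (h3 : (3 : K) ≠ 0) :
    c₄ s ^ 2 * c₂ s ^ 2 - 4 * c₂ s ^ 3 - 4 * c₄ s ^ 3 * c₀ s - 27 * c₀ s ^ 2
      + 18 * c₄ s * c₂ s * c₀ s = -(2 ^ 16 * 3 ^ 2 * 7 * d s ^ 6) := by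
  unfold c₄ c₂ c₀ d
  field_simp
  ring

lemma separable_sextic (h2 : (2 : K) ≠ 0) (h3 : (3 : K) ≠ 0) (h7 : (7 : K) ≠ 0)
    (hs : c₀ s * d s ≠ 0) : (sextic s).Separable := by
  have hD := discr_eq s h3
  have h0 : c₀ s ≠ 0 := left_ne_zero_of_mul hs
  have hd : d s ≠ 0 := right_ne_zero_of_mul hs
  unfold sextic
  generalize c₄ s = b at *
  generalize c₂ s = c at *
  generalize c₀ s = e at *
  generalize d s = δ at *
  have hder : derivative (X ^ 6 + C b * X ^ 4 + C c * X ^ 2 + C e : K[X])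
      = C 2 * X * (3 * X ^ 4 + 2 * C b * X ^ 2 + C c) := by
    simp only [derivative_add, derivative_mul, derivative_X_pow, derivative_C]
    simp only [map_ofNat, map_natCast]
    push_cast
    ring
  rw [Polynomial.Separable, hder]
  have hn : (9 * (2 ^ 16 * 3 ^ 2 * 7 * δ ^ 6) : K) ≠ 0 := by
    have h9 : (9 : K) = 3 ^ 2 := by norm_num
    rw [h9]
    exact mul_ne_zero (pow_ne_zero _ h3) (mul_ne_zero (mul_ne_zero (mul_ne_zero
      (pow_ne_zero _ h2) (pow_ne_zero _ h3)) h7) (pow_ne_zero _ hd))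
  have key : ∀ (p q : K[X]) (n : K), n ≠ 0 → (∃ u v : K[X], u * p + v * q = C n) →
      IsCoprime p q := by
    rintro p q n hn ⟨u, v, h⟩
    refine ⟨C n⁻¹ * u, C n⁻¹ * v, ?_⟩
    have : C n⁻¹ * C n = (1 : K[X]) := by rw [← C_mul, inv_mul_cancel₀ hn, C_1]
    linear_combination C n⁻¹ * h + this
  refine IsCoprime.mul_right (IsCoprime.mul_right ?_ ?_) ?_
  · exact key _ _ 2 h2 ⟨0, 1, by ring⟩
  · exact key _ _ e h0 ⟨1, -(X ^ 5 + C b * X ^ 3 + C c * X), by ring⟩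
  · have hD' := congrArg (C : K → K[X]) hD
    simp only [map_add, map_sub, map_mul, map_pow, map_neg, map_ofNat] at hD'
    refine key _ _ _ hn
      ⟨-9 * (3 * (6 * C c - 2 * C b ^ 2) * X ^ 2 + (2 * C b * (6 * C c - 2 * C b ^ 2)
          - 3 * (9 * C e - C b * C c))),
        (6 * C c - 2 * C b ^ 2) ^ 2 + (3 * (6 * C c - 2 * C b ^ 2) * X ^ 2
          + (2 * C b * (6 * C c - 2 * C b ^ 2) - 3 * (9 * C e - C b * C c))) * (3 * X ^ 2 + C b),
        ?_⟩
    simp only [map_mul, map_pow, map_ofNat]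
    linear_combination (-9) * hD'

/-- The genus-`2` curve `d y² = x⁶ + c₄ x⁴ + c₂ x² + c₀`. -/
def curve (h2 : (2 : K) ≠ 0) (h3 : (3 : K) ≠ 0) (h7 : (7 : K) ≠ 0) (hs : c₀ s * d s ≠ 0) :
    SexticCurve K where
  d := d s
  f := sextic s
  two_ne := h2
  d_ne := right_ne_zero_of_mul hs
  natDegree_f := natDegree_sextic s
  separable_f := separable_sextic s h2 h3 h7 hs

end C24

end

/-! Write the curve as `y² = g(x)` with `g = f / d`. The function `y - c(x)` has norm `c² - g` up to
sign, so every factorisation of `c² - g` is a linear relation between divisor classes. Let `[u, c]`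
be the class of the points `(a, c(a))` with `u(a) = 0`, completed to degree two by a point at
infinity, minus the two points at infinity. Four polynomials give `c² - g = κ₁ u² p`, so `2A + P =
0` with `A = [u, c]`, `P = [p, c]`; `ℓ² - g = κ₂ p² n`, so `2P + N = 0` with `P = [p, ℓ]`, `N = [n,
ℓ]`; `q² - g = κ₃ n⁴` with `q` quartic, so `4N = 0`; `r² - g = κ₄ w³`, so `3T = 0` with `T = [w,
r]`. Hence `8A = 2N` and `16A = 0`. Once `2N ≠ 0` and `T ≠ 0` are known, `A` has order 16, `T` has
order 3 and `A + T` has order 48 (`exists_addOrderOf_eq_forty_eight`).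

Nonvanishing is the hyperelliptic argument (`nsmul_mumfordDiv_not_mem`). A function with divisor
`[u, c]` or `2[u, c]` has no affine poles, so it is `p(x) + q(x) y`, because the coordinate ring is
integrally closed. Its poles at infinity have order at most two while `y` has a pole of order three
at both points, so `q = 0`. The divisor of a polynomial in `x` is symmetric under `y ↦ -y`; that of
the pair is not, since `c(a) ≠ 0`. All this happens over a separable closure, and pairs with
coefficients in `K` give Galois-invariant classes. The divisor of `y - c(x)` itself (`ord_sub`) is
computed from explicit valuations at points where `y ≠ 0`; no Weierstrass point ever occurs.

In the family, `N`, `P` and `T` exist for every `s`. Halving `P` asks for a cubic through the points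
of `P` whose remaining intersection with the curve is twice a pair of points (`tangent_eq`). This
amounts to solving one quadratic equation and extracting one square root, that is, to making two
expressions in `s` squares; the points of the elliptic curve `D` do exactly that (`exists_sq_eq`).
There are two such constructions, with `κ = 32` and `κ = 8`, and they do not degenerate for the same
`s`. -/

/-! ### Quadratic extensions of a rational function field and their rational places -/

/-- `t` is transcendental over `L`, `η ^ 2 = g(t)`, and `F = L(t, η)` is of degree two over `L(t)`. -/
structure IsQuadraticModel {L F : Type*} [Field L] [Field F] [Algebra L F] (t η : F) (g : L[X]) :
    Prop where
  sq : η ^ 2 = aeval t g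
  indep : ∀ p q : L[X], aeval t p + aeval t q * η = 0 → p = 0 ∧ q = 0
  gen : ∀ z : F, ∃ p q r : L[X], r ≠ 0 ∧ z * aeval t r = aeval t p + aeval t q * η

/-- The place `P` lies over the point `t = a`, `η = b`. -/
def Place.Centered {L F : Type*} [Field L] [Field F] [Algebra L F] (P : Place L F) (t η : F)
    (a b : L) : Prop :=
  P.v (t - algebraMap L F a) < 1 ∧ P.v (η - algebraMap L F b) < 1

/-- Elements `p(t) + q(t) η` that do not vanish at the point `t = a`, `η = b`. -/
def nonvanishingAt {L F : Type*} [Field L] [Field F] [Algebra L F] (t η : F) (a b : L) : Set F :=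
  {α | ∃ p q : L[X], α = aeval t p + aeval t q * η ∧ p.eval a + q.eval a * b ≠ 0}

/-! ### Values of functions at a place over a point -/

section Place

variable {L F : Type*} [Field L] [Field F] [Algebra L F] (P : Place L F)

lemma Place.v_algebraMap {c : L} (hc : c ≠ 0) : P.v (algebraMap L F c) = 1 := P.trivial_on c hc

lemma Place.v_aeval_le_one {t : F} (ht : P.v t ≤ 1) (p : L[X]) : P.v (aeval t p) ≤ 1 := by
  induction p using Polynomial.induction_on' with
  | add p q hp hq => rw [map_add]; exact (P.v.map_add _ _).trans (max_le hp hq)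
  | monomial n a =>
    rw [aeval_monomial, map_mul, map_pow]
    exact mul_le_one' (P.v_algebraMap_le_one a) (pow_le_one' ht n)

lemma Place.v_le_one_of_v_sub_lt_one {t : F} {a : L} (h : P.v (t - algebraMap L F a) < 1) :
    P.v t ≤ 1 := by
  have := P.v.map_add (t - algebraMap L F a) (algebraMap L F a)
  rw [sub_add_cancel] at this
  exact this.trans (max_le h.le (P.v_algebraMap_le_one a))

lemma Place.v_aeval_sub_lt_one {t : F} {a : L} (h : P.v (t - algebraMap L F a) < 1) (p : L[X]) :
    P.v (aeval t p - algebraMap L F (p.eval a)) < 1 := by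
  obtain ⟨q, hq⟩ := X_sub_C_dvd_sub_C_eval (a := a) (p := p)
  have : aeval t p - algebraMap L F (p.eval a) = (t - algebraMap L F a) * aeval t q := by
    have := congrArg (aeval t) hq
    simpa using this
  rw [this, map_mul]
  exact (mul_le_of_le_one_right' (P.v_aeval_le_one (P.v_le_one_of_v_sub_lt_one h) q)).trans_lt h

lemma Place.v_eq_one_of_v_sub_lt_one {z : F} {c : L} (hc : c ≠ 0)
    (h : P.v (z - algebraMap L F c) < 1) : P.v z = 1 := by
  have h1 : P.v (algebraMap L F c) = 1 := P.v_algebraMap hc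
  rw [← h1, ← sub_add_cancel z (algebraMap L F c)]
  rw [← h1] at h
  exact Valuation.map_add_eq_of_lt_right _ h

lemma Place.eq_of_v_sub_lt_one {z : F} {a a' : L} (h : P.v (z - algebraMap L F a) < 1)
    (h' : P.v (z - algebraMap L F a') < 1) : a = a' := by
  by_contra hne
  have := P.v.map_sub (z - algebraMap L F a') (z - algebraMap L F a)
  rw [show z - algebraMap L F a' - (z - algebraMap L F a) = algebraMap L F (a - a') by
    rw [map_sub]; ring, P.v_algebraMap (sub_ne_zero.2 hne)] at this
  exact absurd this (not_le.2 (max_lt h' h))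

lemma Place.Centered.v_sub_lt_one {P : Place L F} {t η : F} {a b : L} (h : P.Centered t η a b)
    (p q : L[X]) :
    P.v (aeval t p + aeval t q * η - algebraMap L F (p.eval a + q.eval a * b)) < 1 := by
  have h1 := P.v_aeval_sub_lt_one h.1 p
  have h2 := P.v_aeval_sub_lt_one h.1 q
  have hη := P.v_le_one_of_v_sub_lt_one h.2
  have : aeval t p + aeval t q * η - algebraMap L F (p.eval a + q.eval a * b) =
      (aeval t p - algebraMap L F (p.eval a)) + ((aeval t q - algebraMap L F (q.eval a)) * η +
        algebraMap L F (q.eval a) * (η - algebraMap L F b)) := by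
    simp only [map_add, map_mul]; ring
  rw [this]
  refine P.v.map_add_lt h1 (P.v.map_add_lt ?_ ?_)
  · rw [map_mul]; exact (mul_le_of_le_one_right' hη).trans_lt h2
  · rw [map_mul]; exact (mul_le_of_le_one_left' (P.v_algebraMap_le_one _)).trans_lt h.2

lemma Place.Centered.v_eq_one {P : Place L F} {t η : F} {a b : L} (h : P.Centered t η a b)
    {α : F} (hα : α ∈ nonvanishingAt t η a b) : P.v α = 1 := by
  obtain ⟨p, q, rfl, h0⟩ := hα
  exact P.v_eq_one_of_v_sub_lt_one h0 (h.v_sub_lt_one p q)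

end Place

lemma exists_pow_mul_and_eval_ne_zero {L : Type*} [Field L] (a : L) (p q : L[X])
    (h : ¬(p = 0 ∧ q = 0)) : ∃ (k : ℕ) (p₀ q₀ : L[X]), p = (X - C a) ^ k * p₀ ∧
      q = (X - C a) ^ k * q₀ ∧ ¬(p₀.eval a = 0 ∧ q₀.eval a = 0) := by
  have key : ∀ r : L[X], r ≠ 0 → ∃ (k : ℕ) (r₀ : L[X]), r = (X - C a) ^ k * r₀ ∧
      r₀.eval a ≠ 0 := by
    intro r hr
    obtain ⟨r₀, h1, h2⟩ := exists_eq_pow_rootMultiplicity_mul_and_not_dvd r hr a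
    exact ⟨_, r₀, h1, fun h0 => h2 (dvd_iff_isRoot.2 h0)⟩
  by_cases hp : p = 0
  · obtain ⟨k, r, h1, h2⟩ := key q (fun hq => h ⟨hp, hq⟩)
    exact ⟨k, 0, r, by simp [hp], h1, fun h => h2 h.2⟩
  by_cases hq : q = 0
  · obtain ⟨k, r, h1, h2⟩ := key p hp
    exact ⟨k, r, 0, h1, by simp [hq], fun h => h2 h.1⟩
  obtain ⟨i, p₁, h1, h2⟩ := key p hp
  obtain ⟨j, q₁, h3, h4⟩ := key q hq
  rcases le_total i j with hij | hij
  · refine ⟨i, p₁, (X - C a) ^ (j - i) * q₁, h1, ?_, fun h => h2 h.1⟩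
    rw [← mul_assoc, ← pow_add, Nat.add_sub_cancel' hij, h3]
  · refine ⟨j, (X - C a) ^ (i - j) * p₁, q₁, ?_, h3, fun h => h4 h.2⟩
    rw [← mul_assoc, ← pow_add, Nat.add_sub_cancel' hij, h1]

/-! ### The valuation at a rational point with `η ≠ 0` -/

namespace IsQuadraticModel

variable {L F : Type*} [Field L] [Field F] [Algebra L F] {t η : F} {g : L[X]}
  (H : IsQuadraticModel t η g)
include H

lemma aeval_eq_zero {p : L[X]} (h : aeval t p = 0) : p = 0 :=
  (H.indep p 0 (by simp [h])).1

lemma aeval_ne_zero {p : L[X]} (h : p ≠ 0) : aeval t p ≠ 0 := fun h0 => h (H.aeval_eq_zero h0)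

lemma sub_ne_zero (a : L) : t - algebraMap L F a ≠ 0 := by
  have := H.aeval_ne_zero (X_sub_C_ne_zero a)
  simpa using this

lemma ext_coeff {p q p' q' : L[X]}
    (h : aeval t p + aeval t q * η = aeval t p' + aeval t q' * η) : p = p' ∧ q = q' := by
  have := H.indep (p - p') (q - q') (by simp only [map_sub]; linear_combination h)
  exact ⟨sub_eq_zero.1 this.1, sub_eq_zero.1 this.2⟩

lemma mul_conj (p q : L[X]) : (aeval t p + aeval t q * η) * (aeval t p - aeval t q * η) =
    aeval t (p ^ 2 - q ^ 2 * g) := by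
  simp only [map_sub, map_mul, map_pow, ← H.sq]; ring

lemma norm_ne_zero {p q : L[X]} (h : ¬(p = 0 ∧ q = 0)) : p ^ 2 - q ^ 2 * g ≠ 0 := by
  intro h0
  have := H.mul_conj p q
  rw [h0, map_zero] at this
  rcases mul_eq_zero.1 this with h1 | h1
  · exact h (H.indep _ _ h1)
  · have := H.indep p (-q) (by simp only [map_neg]; linear_combination h1)
    exact h ⟨this.1, neg_eq_zero.1 this.2⟩

variable {a b : L} (hb : b ≠ 0) (hab : b ^ 2 = g.eval a)

lemma ne_zero_of_mem {α : F} (hα : α ∈ nonvanishingAt t η a b) : α ≠ 0 := by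
  obtain ⟨p, q, rfl, h0⟩ := hα
  intro h
  obtain ⟨rfl, rfl⟩ := H.indep _ _ h
  simp at h0

include hab in
lemma mul_mem {α β : F} (hα : α ∈ nonvanishingAt t η a b) (hβ : β ∈ nonvanishingAt t η a b) :
    α * β ∈ nonvanishingAt t η a b := by
  obtain ⟨p, q, rfl, h0⟩ := hα
  obtain ⟨p', q', rfl, h0'⟩ := hβ
  refine ⟨p * p' + q * q' * g, p * q' + p' * q, ?_, ?_⟩
  · simp only [map_add, map_mul, ← H.sq]; ring
  · convert mul_ne_zero h0 h0' using 1
    simp only [eval_add, eval_mul, ← hab]; ring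

omit H in
lemma one_mem : (1 : F) ∈ nonvanishingAt t η a b := ⟨1, 0, by simp, by simp⟩

include hb in
/-- The local shape of a nonzero element of `L[t, η]` at a rational point with `η ≠ 0`. -/
lemma exists_eq_pow_mul_div (h2 : (2 : L) ≠ 0) {p q : L[X]} (hpq : ¬(p = 0 ∧ q = 0)) :
    ∃ k : ℕ, ∃ α ∈ nonvanishingAt t η a b, ∃ β ∈ nonvanishingAt t η a b,
      aeval t p + aeval t q * η = (t - algebraMap L F a) ^ k * (α / β) := by
  obtain ⟨k, p₀, q₀, rfl, rfl, h0⟩ := exists_pow_mul_and_eval_ne_zero a p q hpq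
  by_cases hv : p₀.eval a + q₀.eval a * b = 0
  -- Here `p₀ + q₀ η` vanishes at the point. Its conjugate takes the value `-2 q₀(a) b ≠ 0` there,
  -- so the element is the norm, a polynomial in `t`, divided by a unit.
  · have hq : q₀.eval a ≠ 0 := fun hq => h0 ⟨by simpa [hq] using hv, hq⟩
    have hpq₀ : ¬(p₀ = 0 ∧ q₀ = 0) := fun h => hq (by simp [h.2])
    obtain ⟨n₀, hn, hn0⟩ := exists_eq_pow_rootMultiplicity_mul_and_not_dvd _
      (H.norm_ne_zero hpq₀) a
    have hconj : aeval t p₀ - aeval t q₀ * η ∈ nonvanishingAt t η a b := by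
      refine ⟨p₀, -q₀, by simp [sub_eq_add_neg], ?_⟩
      rw [eval_neg, show p₀.eval a + -q₀.eval a * b = -(2 * (q₀.eval a * b)) by
        linear_combination hv]
      exact neg_ne_zero.2 (mul_ne_zero h2 (mul_ne_zero hq hb))
    have hc := H.ne_zero_of_mem hconj
    refine ⟨k + rootMultiplicity a (p₀ ^ 2 - q₀ ^ 2 * g), aeval t n₀,
      ⟨n₀, 0, by simp, fun h => hn0 (dvd_iff_isRoot.2 (by simpa using h))⟩, _, hconj, ?_⟩
    have := H.mul_conj p₀ q₀
    rw [hn] at this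
    simp only [map_mul, map_pow, map_sub, aeval_X, aeval_C] at this ⊢
    rw [pow_add]
    field_simp
    linear_combination (t - algebraMap L F a) ^ k * this
  · refine ⟨k, _, ⟨p₀, q₀, rfl, hv⟩, 1, one_mem, ?_⟩
    simp only [map_mul, map_pow, map_sub, aeval_X, aeval_C]
    ring

include hb hab in
/-- The local shape of a nonzero element of `F` at a rational point with `η ≠ 0`. -/
lemma exists_eq_zpow_mul_div (h2 : (2 : L) ≠ 0) {z : F} (hz : z ≠ 0) :
    ∃ k : ℤ, ∃ α ∈ nonvanishingAt t η a b, ∃ β ∈ nonvanishingAt t η a b,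
      z = (t - algebraMap L F a) ^ k * (α / β) := by
  obtain ⟨p, q, r, hr, h⟩ := H.gen z
  have hr' := H.aeval_ne_zero hr
  have hpq : ¬(p = 0 ∧ q = 0) := by
    rintro ⟨rfl, rfl⟩
    simp [hz, hr'] at h
  obtain ⟨k, α, hα, β, hβ, e1⟩ := H.exists_eq_pow_mul_div hb h2 hpq
  obtain ⟨l, γ, hγ, δ, hδ, e2⟩ := H.exists_eq_pow_mul_div (p := r) (q := 0) hb h2
    (fun h => hr h.1)
  refine ⟨k - l, α * δ, H.mul_mem hab hα hδ, β * γ, H.mul_mem hab hβ hγ, ?_⟩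
  have h0 := H.sub_ne_zero a
  have hβ0 := H.ne_zero_of_mem hβ
  have hδ0 := H.ne_zero_of_mem hδ
  have hγ0 := H.ne_zero_of_mem hγ
  rw [map_zero, zero_mul, add_zero] at e2
  rw [zpow_sub₀ h0, zpow_natCast, zpow_natCast]
  rw [e1] at h
  rw [e2] at h hr'
  field_simp at h ⊢
  linear_combination h

omit H in
lemma _root_.Place.Centered.v_eq_zpow {P : Place L F} (hP : P.Centered t η a b) {z α β : F}
    {k : ℤ} (hα : α ∈ nonvanishingAt t η a b) (hβ : β ∈ nonvanishingAt t η a b)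
    (hz : z = (t - algebraMap L F a) ^ k * (α / β)) : P.v z = P.v (t - algebraMap L F a) ^ k := by
  rw [hz, map_mul, map_div₀, hP.v_eq_one hα, hP.v_eq_one hβ, map_zpow₀]
  simp

include hb hab in
-- By the local shape every value is a power of the value of `t - a`. As the valuation is onto, this
-- value generates `ℤ`; it is less than one, which leaves only `exp (-1)`.
lemma v_uniformizer (h2 : (2 : L) ≠ 0) {P : Place L F} (hP : P.Centered t η a b) :
    P.v (t - algebraMap L F a) = WithZero.exp (-1) := by
  obtain ⟨z, hz⟩ := P.surjective (WithZero.exp (-1))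
  have hz0 : z ≠ 0 := by
    rintro rfl
    rw [map_zero] at hz
    exact WithZero.exp_ne_zero hz.symm
  obtain ⟨k, α, hα, β, hβ, e⟩ := H.exists_eq_zpow_mul_div hb hab h2 hz0
  have hv := hP.v_eq_zpow hα hβ e
  have h0 : P.v (t - algebraMap L F a) ≠ 0 := (Valuation.ne_zero_iff _).2 (H.sub_ne_zero a)
  obtain ⟨m, hm⟩ : ∃ m : ℤ, P.v (t - algebraMap L F a) = WithZero.exp m :=
    ⟨_, (WithZero.exp_log h0).symm⟩
  have hlt := hP.1
  rw [hm] at hlt hv ⊢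
  rw [hz, ← WithZero.exp_zsmul, WithZero.exp_inj, smul_eq_mul] at hv
  rw [← WithZero.exp_zero, WithZero.exp_lt_exp] at hlt
  have : m ∣ 1 := ⟨-k, by linear_combination -hv⟩
  rcases Int.isUnit_iff.1 (isUnit_of_dvd_one this) with h | h
  · omega
  · rw [h]

include hb hab in
lemma eq_of_centered (h2 : (2 : L) ≠ 0) {P Q : Place L F} (hP : P.Centered t η a b)
    (hQ : Q.Centered t η a b) : P = Q := by
  ext z
  by_cases hz : z = 0
  · simp [hz]
  obtain ⟨k, α, hα, β, hβ, e⟩ := H.exists_eq_zpow_mul_div hb hab h2 hz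
  rw [hP.v_eq_zpow hα hβ e, hQ.v_eq_zpow hα hβ e, H.v_uniformizer hb hab h2 hP,
    H.v_uniformizer hb hab h2 hQ]

include hb hab in
lemma exists_v_sub_lt_one (h2 : (2 : L) ≠ 0) {P : Place L F} (hP : P.Centered t η a b) {z : F}
    (hz : P.v z ≤ 1) : ∃ c : L, P.v (z - algebraMap L F c) < 1 := by
  by_cases hz0 : z = 0
  · exact ⟨0, by simp [hz0]⟩
  obtain ⟨k, α, hα, β, hβ, e⟩ := H.exists_eq_zpow_mul_div hb hab h2 hz0
  have hv := hP.v_eq_zpow hα hβ e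
  rcases hz.lt_or_eq with h | h
  · exact ⟨0, by simpa using h⟩
  have hk : k = 0 := by
    rw [hv, H.v_uniformizer hb hab h2 hP, ← WithZero.exp_zsmul, ← WithZero.exp_zero,
      WithZero.exp_inj, smul_eq_mul] at h
    omega
  rw [hk, zpow_zero, one_mul] at e
  have hβv := hP.v_eq_one hβ
  have hβ0 := H.ne_zero_of_mem hβ
  obtain ⟨p, q, rfl, h0⟩ := hα
  obtain ⟨p', q', rfl, h0'⟩ := hβ
  set c := p.eval a + q.eval a * b
  set c' := p'.eval a + q'.eval a * b
  refine ⟨c / c', ?_⟩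
  have hc' : algebraMap L F c' ≠ 0 := by simpa using h0'
  have h1 := hP.v_sub_lt_one p q
  have h1' := hP.v_sub_lt_one p' q'
  have : (z - algebraMap L F (c / c')) * (aeval t p' + aeval t q' * η) =
      (aeval t p + aeval t q * η - algebraMap L F c) -
        algebraMap L F (c / c') * (aeval t p' + aeval t q' * η - algebraMap L F c') := by
    rw [sub_mul, e, div_mul_cancel₀ _ hβ0, map_div₀]
    field_simp
    ring
  have h3 := congrArg P.v this
  rw [map_mul, hβv, mul_one] at h3
  rw [h3]
  refine (P.v.map_sub _ _).trans_lt (max_lt h1 ?_)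
  rw [map_mul]
  exact (mul_le_of_le_one_left' (P.v_algebraMap_le_one _)).trans_lt h1'

include hb hab in
-- The residue field is `L`: an element of order zero is a quotient `α / β` of nonvanishing
-- elements, congruent to the quotient of their values at the point.
lemma degree_eq_one (h2 : (2 : L) ≠ 0) {P : Place L F} (hP : P.Centered t η a b) :
    P.degree = 1 := by
  have h1 : (1 : F) ∈ P.valuationRing := show P.v 1 ≤ 1 by simp
  rw [Place.degree, finrank_eq_one (Submodule.Quotient.mk ⟨1, h1⟩)]
  · simp
  · rw [Ne, Submodule.Quotient.mk_eq_zero]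
    intro h
    have : P.v (1 : F) < 1 := h
    simp at this
  · intro w
    obtain ⟨⟨z, hz⟩, rfl⟩ := Submodule.Quotient.mk_surjective _ w
    obtain ⟨c, hc⟩ := H.exists_v_sub_lt_one hb hab h2 hP hz
    refine ⟨c, ?_⟩
    rw [← Submodule.Quotient.mk_smul, eq_comm, Submodule.Quotient.eq]
    change P.v (z - c • (1 : F)) < 1
    rwa [Algebra.smul_def, mul_one]

/-- Comparing coefficients of `1` and `η`, both components of `β` would be divisible by `X - a`, so
`β` would vanish at the point. This is what makes the exponent in the local shape well defined. -/
lemma pow_mul_ne {n : ℕ} (hn : n ≠ 0) {α β : F} (hα : α ∈ nonvanishingAt t η a b)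
    (hβ : β ∈ nonvanishingAt t η a b) : (t - algebraMap L F a) ^ n * α ≠ β := by
  obtain ⟨p, q, rfl, h0⟩ := hα
  obtain ⟨p', q', rfl, h0'⟩ := hβ
  intro h
  obtain ⟨rfl, rfl⟩ := H.ext_coeff (p := (X - C a) ^ n * p) (q := (X - C a) ^ n * q)
    (p' := p') (q' := q') (by
      rw [← h]
      simp only [map_mul, map_pow, map_sub, aeval_X, aeval_C]
      ring)
  simp [hn] at h0'

include hab in
lemma zpow_le_of_eq {k l : ℤ} {α β α' β' : F} (hα : α ∈ nonvanishingAt t η a b)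
    (hβ : β ∈ nonvanishingAt t η a b) (hα' : α' ∈ nonvanishingAt t η a b)
    (hβ' : β' ∈ nonvanishingAt t η a b)
    (h : (t - algebraMap L F a) ^ k * (α / β) = (t - algebraMap L F a) ^ l * (α' / β')) :
    k ≤ l := by
  by_contra! hlt
  obtain ⟨n, hn⟩ := Int.eq_ofNat_of_zero_le (sub_nonneg.2 hlt.le)
  refine H.pow_mul_ne (n := n) (by rintro rfl; simp at hn; omega) (H.mul_mem hab hα hβ')
    (H.mul_mem hab hα' hβ) ?_
  have h0 := H.sub_ne_zero a
  have h1 := H.ne_zero_of_mem hβ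
  have h2 := H.ne_zero_of_mem hβ'
  rw [show k = l + n by omega, zpow_add₀ h0, zpow_natCast] at h
  have h3 := zpow_ne_zero l h0
  field_simp at h
  linear_combination h

include hb hab in
lemma min_le_of_add (h2 : (2 : L) ≠ 0) {k l m : ℤ} (hkl : k ≤ l)
    {α β α' β' α'' β'' : F} (hα : α ∈ nonvanishingAt t η a b)
    (hβ : β ∈ nonvanishingAt t η a b) (hα' : α' ∈ nonvanishingAt t η a b)
    (hβ' : β' ∈ nonvanishingAt t η a b) (hα'' : α'' ∈ nonvanishingAt t η a b)
    (hβ'' : β'' ∈ nonvanishingAt t η a b)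
    (h : (t - algebraMap L F a) ^ k * (α / β) + (t - algebraMap L F a) ^ l * (α' / β') =
      (t - algebraMap L F a) ^ m * (α'' / β'')) : k ≤ m := by
  obtain ⟨n, hn⟩ := Int.eq_ofNat_of_zero_le (sub_nonneg.2 hkl)
  have h0 := H.sub_ne_zero a
  have e1 := H.ne_zero_of_mem hβ
  have e2 := H.ne_zero_of_mem hβ'
  have e3 := H.ne_zero_of_mem hβ''
  have e4 := H.ne_zero_of_mem hα''
  obtain ⟨p, q, hpq, -⟩ := H.mul_mem hab hα hβ'
  obtain ⟨p', q', hpq', -⟩ := H.mul_mem hab hα' hβ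
  have hs : aeval t (p + (X - C a) ^ n * p') + aeval t (q + (X - C a) ^ n * q') * η =
      α * β' + (t - algebraMap L F a) ^ n * (α' * β) := by
    rw [hpq, hpq']
    simp only [map_add, map_mul, map_pow, map_sub, aeval_X, aeval_C]
    ring
  have hz := zpow_ne_zero k h0
  rw [show l = k + n by omega, zpow_add₀ h0, zpow_natCast] at h
  have hs' : (t - algebraMap L F a) ^ k * (α * β' + (t - algebraMap L F a) ^ n * (α' * β)) =
      (t - algebraMap L F a) ^ m * (α'' * (β * β') / β'') := by
    field_simp at h ⊢
    linear_combination h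
  have hne : ¬(p + (X - C a) ^ n * p' = 0 ∧ q + (X - C a) ^ n * q' = 0) := by
    rintro ⟨h1, h1'⟩
    rw [h1, h1', map_zero, zero_mul, add_zero] at hs
    rw [← hs, mul_zero] at hs'
    have := mul_ne_zero (zpow_ne_zero m h0) (div_ne_zero (mul_ne_zero e4 (mul_ne_zero e1 e2)) e3)
    exact this hs'.symm
  -- The bracket is a polynomial in `t` and `η`, so its exponent `j` is a natural number; uniqueness
  -- of exponents then gives `k + j ≤ m`.
  obtain ⟨j, γ, hγ, δ, hδ, e⟩ := H.exists_eq_pow_mul_div hb h2 hne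
  rw [← hs, e, ← mul_assoc, ← zpow_natCast, ← zpow_add₀ h0] at hs'
  have := H.zpow_le_of_eq hab hγ hδ (H.mul_mem hab hα'' (H.mul_mem hab hβ hβ')) hβ'' hs'
  omega

include hb hab in
-- The exponent of `t - a` in the local shape is well defined, additive on products and ultrametric
-- on sums, so it is itself the valuation sought.
lemma exists_centered (h2 : (2 : L) ≠ 0) : ∃ P : Place L F, P.Centered t η a b := by
  classical
  choose! k α hα β hβ e using fun (z : F) (hz : z ≠ 0) => H.exists_eq_zpow_mul_div hb hab h2 hz
  have h0 := H.sub_ne_zero a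
  have huniq : ∀ {z : F} (_ : z ≠ 0) {l : ℤ} {γ δ : F} (_ : γ ∈ nonvanishingAt t η a b)
      (_ : δ ∈ nonvanishingAt t η a b), z = (t - algebraMap L F a) ^ l * (γ / δ) → k z = l := by
    intro z hz l γ δ hγ hδ hl
    have := (e z hz).symm.trans hl
    exact le_antisymm (H.zpow_le_of_eq hab (hα z hz) (hβ z hz) hγ hδ this)
      (H.zpow_le_of_eq hab hγ hδ (hα z hz) (hβ z hz) this.symm)
  have hmul : ∀ {z w : F}, z ≠ 0 → w ≠ 0 → k (z * w) = k z + k w := by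
    intro z w hz hw
    refine huniq (mul_ne_zero hz hw) (H.mul_mem hab (hα z hz) (hα w hw))
      (H.mul_mem hab (hβ z hz) (hβ w hw)) ?_
    conv_lhs => rw [e z hz, e w hw]
    rw [zpow_add₀ h0]
    ring
  have hadd : ∀ {z w : F}, z ≠ 0 → w ≠ 0 → z + w ≠ 0 → k z ≤ k w → k z ≤ k (z + w) := by
    intro z w hz hw hzw hle
    refine H.min_le_of_add hb hab h2 hle (hα z hz) (hβ z hz) (hα w hw) (hβ w hw)
      (hα _ hzw) (hβ _ hzw) ?_
    rw [← e z hz, ← e w hw, ← e _ hzw]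
  let v : Valuation F ℤᵐ⁰ :=
    { toFun := fun z => if z = 0 then 0 else WithZero.exp (-k z)
      map_zero' := by simp
      map_one' := by
        have : k 1 = 0 := huniq one_ne_zero one_mem one_mem (by simp)
        simp [this]
      map_mul' := by
        intro z w
        by_cases hz : z = 0
        · simp [hz]
        by_cases hw : w = 0
        · simp [hw]
        simp only [hz, hw, mul_eq_zero, or_self, if_false]
        rw [hmul hz hw, ← WithZero.exp_add]
        congr 1
        ring
      map_add_le_max' := by
        intro z w
        by_cases hz : z = 0
        · simp [hz]
        by_cases hw : w = 0
        · simp [hw]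
        by_cases hzw : z + w = 0
        · simp [hzw]
        simp only [hz, hw, hzw, if_false, le_max_iff, WithZero.exp_le_exp, neg_le_neg_iff]
        rcases le_total (k z) (k w) with h | h
        · exact Or.inl (hadd hz hw hzw h)
        · right
          rw [add_comm] at hzw ⊢
          exact hadd hw hz hzw h }
  have hv : ∀ {z : F} (_ : z ≠ 0) {l : ℤ} {γ δ : F} (_ : γ ∈ nonvanishingAt t η a b)
      (_ : δ ∈ nonvanishingAt t η a b), z = (t - algebraMap L F a) ^ l * (γ / δ) →
      v z = WithZero.exp (-l) := by
    intro z hz l γ δ hγ hδ h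
    rw [← huniq hz hγ hδ h]
    exact if_neg hz
  have hvt : v (t - algebraMap L F a) = WithZero.exp (-1) :=
    hv h0 one_mem one_mem (by simp)
  refine ⟨⟨v, fun y => ?_, fun c hc => ?_⟩, ?_, ?_⟩
  · by_cases hy : y = 0
    · exact ⟨0, by simp [hy]⟩
    · refine ⟨(t - algebraMap L F a) ^ (-WithZero.log y), ?_⟩
      rw [map_zpow₀, hvt, ← WithZero.exp_zsmul]
      simp [WithZero.exp_log hy]
  · have := hv (z := algebraMap L F c) (l := 0) (γ := algebraMap L F c) (δ := 1) (by simpa using hc)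
      ⟨C c, 0, by simp, by simpa using hc⟩ one_mem (by simp)
    simpa using this
  · change v _ < 1
    rw [hvt, ← WithZero.exp_zero, WithZero.exp_lt_exp]
    norm_num
  · change v _ < 1
    by_cases hz : η - algebraMap L F b = 0
    · simp [hz]
    -- Since `2b ≠ 0`, the factor `η + b` is a unit. As `(η - b)(η + b) = g(t) - g(a)` is divisible
    -- by `t - a`, the factor `η - b` has positive order.
    have hc : η + algebraMap L F b ∈ nonvanishingAt t η a b :=
      ⟨C b, 1, by simp [add_comm], by
        simpa [← two_mul] using ⟨h2, hb⟩⟩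
    obtain ⟨g₁, hg₁⟩ := X_sub_C_dvd_sub_C_eval (a := a) (p := g)
    have hprod : (η - algebraMap L F b) * (η + algebraMap L F b) =
        (t - algebraMap L F a) * aeval t g₁ := by
      have h1 := congrArg (aeval t) hg₁
      simp only [map_sub, map_mul, aeval_X, aeval_C, ← H.sq, ← hab, map_pow] at h1
      linear_combination h1
    have hle : v (aeval t g₁) ≤ 1 := by
      by_cases h : g₁ = 0
      · simp [h]
      obtain ⟨j, γ, hγ, δ, hδ, h'⟩ := H.exists_eq_pow_mul_div (p := g₁) (q := 0) hb h2
        (fun h' => h h'.1)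
      rw [map_zero, zero_mul, add_zero] at h'
      rw [hv (H.aeval_ne_zero h) hγ hδ (l := j) (by rw [h', zpow_natCast]), ← WithZero.exp_zero,
        WithZero.exp_le_exp]
      omega
    have hvc : v (η + algebraMap L F b) = 1 := by
      rw [hv (H.ne_zero_of_mem hc) hc one_mem (l := 0) (by simp)]
      simp
    have := congrArg v hprod
    rw [map_mul, map_mul, hvc, mul_one, hvt] at this
    rw [this]
    refine (mul_le_of_le_one_right' hle).trans_lt ?_
    rw [← WithZero.exp_zero, WithZero.exp_lt_exp]
    norm_num

end IsQuadraticModel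

/-! ### The divisor of `η - c(t)` -/

lemma aeval_inv_reflect_mul_pow {L F : Type*} [Field L] [Field F] [Algebra L F] {t : F}
    (ht : t ≠ 0) {N : ℕ} {p : L[X]} (hp : p.natDegree ≤ N) :
    aeval t⁻¹ (p.reflect N) * t ^ N = aeval t p := by
  let _ := invertibleOfNonzero ht
  have := eval₂_reflect_mul_pow (algebraMap L F) t N p hp
  rwa [invOf_eq_inv] at this

section PointDivisor

variable {L F : Type*} [Field L] [Field F] [Algebra L F]

open Classical in
/-- The place over `t = a`, `η = b` as a divisor (zero if there is no such place). -/
noncomputable def ptDiv (t η : F) (a b : L) : Divisor L F :=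
  if h : ∃ P : Place L F, P.Centered t η a b then Finsupp.single h.choose 1 else 0

lemma Place.ord_eq_neg_log (P : Place L F) (z : F) : P.ord z = -WithZero.log (P.v z) := rfl

lemma Place.ord_eq_zero {P : Place L F} {z : F} (h : P.v z = 1) : P.ord z = 0 := by
  simp [Place.ord, h]

lemma Place.ord_of_v_eq_exp {P : Place L F} {z : F} {m : ℤ} (h : P.v z = WithZero.exp m) :
    P.ord z = -m := by
  simp [Place.ord, h]

namespace IsQuadraticModel

variable {t η : F} {g : L[X]} (H : IsQuadraticModel t η g)
include H

lemma eval_eq_of_centered {P : Place L F} {a b : L} (hP : P.Centered t η a b) :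
    b ^ 2 = g.eval a := by
  refine P.eq_of_v_sub_lt_one (z := aeval t g) ?_ (P.v_aeval_sub_lt_one hP.1 g)
  rw [← H.sq, map_pow, sq_sub_sq, map_mul]
  refine (mul_le_of_le_one_left' ?_).trans_lt hP.2
  exact (P.v.map_add _ _).trans
    (max_le (P.v_le_one_of_v_sub_lt_one hP.2) (P.v_algebraMap_le_one b))

open Classical in
lemma ptDiv_apply (h2 : (2 : L) ≠ 0) {a b : L} (hb : b ≠ 0) (P : Place L F) :
    ptDiv t η a b P = if P.Centered t η a b then 1 else 0 := by
  by_cases h : ∃ Q : Place L F, Q.Centered t η a b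
  · have hs := h.choose_spec
    rw [ptDiv, dif_pos h]
    by_cases hP : P.Centered t η a b
    · rw [if_pos hP, H.eq_of_centered hb (H.eval_eq_of_centered hP) h2 hP hs,
        Finsupp.single_eq_same]
    · rw [if_neg hP, Finsupp.single_apply, if_neg]
      intro h'
      exact hP (h' ▸ hs)
  · rw [ptDiv, dif_neg h, if_neg fun hP => h ⟨P, hP⟩, Finsupp.zero_apply]

lemma degree_ptDiv (h2 : (2 : L) ≠ 0) {a b : L} (hb : b ≠ 0) (hab : b ^ 2 = g.eval a) :
    Divisor.degree L F (ptDiv t η a b) = 1 := by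
  have h := H.exists_centered hb hab h2
  rw [ptDiv, dif_pos h, Divisor.degree, Finsupp.liftAddHom_apply_single]
  simp [H.degree_eq_one hb hab h2 h.choose_spec]

lemma v_eta_le_one {P : Place L F} (ht : P.v t ≤ 1) : P.v η ≤ 1 := by
  have := P.v_aeval_le_one ht g
  rw [← H.sq, map_pow] at this
  exact (pow_le_one_iff two_ne_zero).1 this

/-- The norm identity: zeros of `η - c(t)` are sought among the roots of `c² - g`. -/
lemma sub_mul_add (c : L[X]) : (η - aeval t c) * (η + aeval t c) = -aeval t (c ^ 2 - g) := by
  rw [map_sub, map_pow, ← H.sq]; ring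

/-- At a point with `η = c(a) ≠ 0` the conjugate factor `η + c(t)` has the value `2c(a)` and is a
unit, so `η - c(t)` carries the whole order of the norm. -/
lemma ord_sub_of_centered (h2 : (2 : L) ≠ 0) {P : Place L F} {a : L} {c n₀ : L[X]}
    (hP : P.Centered t η a (c.eval a)) (hc : c.eval a ≠ 0) {k : ℕ}
    (hn : c ^ 2 - g = (X - C a) ^ k * n₀) (hn₀ : n₀.eval a ≠ 0) :
    P.ord (η - aeval t c) = k := by
  have h1 : P.v (η + aeval t c) = 1 := hP.v_eq_one ⟨c, 1, by simp [add_comm], by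
    simpa [← two_mul] using ⟨h2, hc⟩⟩
  have h3 : P.v (aeval t n₀) = 1 := hP.v_eq_one ⟨n₀, 0, by simp, by simpa using hn₀⟩
  have h4 := congrArg P.v (H.sub_mul_add c)
  rw [hn, Valuation.map_neg, map_mul, h1, mul_one, map_mul, map_mul, h3, mul_one, map_pow, map_pow,
    show aeval t (X - C a) = t - algebraMap L F a by simp, H.v_uniformizer hc (H.eval_eq_of_centered hP) h2 hP,
    ← WithZero.exp_nsmul] at h4
  rw [P.ord_of_v_eq_exp h4]
  simp

lemma v_sub_eq_one {P : Place L F} (ht : P.v t ≤ 1) {c : L[X]}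
    (h : P.v (aeval t (c ^ 2 - g)) = 1) : P.v (η - aeval t c) = 1 := by
  have h1 : P.v (η - aeval t c) ≤ 1 :=
    (P.v.map_sub _ _).trans (max_le (H.v_eta_le_one ht) (P.v_aeval_le_one ht c))
  have h2 : P.v (η + aeval t c) ≤ 1 :=
    (P.v.map_add _ _).trans (max_le (H.v_eta_le_one ht) (P.v_aeval_le_one ht c))
  have h3 := congrArg P.v (H.sub_mul_add c)
  rw [map_mul, Valuation.map_neg, h] at h3
  exact le_antisymm h1 (h3 ▸ mul_le_of_le_one_right' h2)

omit H in
lemma _root_.Place.exists_root_of_v_lt_one {P : Place L F} {n : L[X]} (hn : n ≠ 0)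
    (hs : n.Splits) (h : P.v (aeval t n) < 1) : ∃ a ∈ n.roots, P.v (t - algebraMap L F a) < 1 := by
  by_contra! hcon
  rw [hs.eq_prod_roots] at h
  rw [map_mul, aeval_C, map_mul, P.v_algebraMap (leadingCoeff_ne_zero.2 hn), one_mul,
    map_multiset_prod, map_multiset_prod, Multiset.map_map, Multiset.map_map] at h
  refine absurd h (not_lt.2 (Multiset.one_le_prod_of_one_le ?_))
  simp only [Multiset.mem_map, Function.comp_apply, map_sub, aeval_X, aeval_C]
  rintro _ ⟨a, ha, rfl⟩
  exact hcon a ha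

lemma ord_sub_of_v_le_one (h2 : (2 : L) ≠ 0) {P : Place L F} (ht : P.v t ≤ 1) {c : L[X]}
    (hs : (c ^ 2 - g).Splits) (hc : ∀ a ∈ (c ^ 2 - g).roots, c.eval a ≠ 0) :
    P.ord (η - aeval t c) = ((c ^ 2 - g).roots.map fun a => ptDiv t η a (c.eval a)).sum P := by
  classical
  set n := c ^ 2 - g with hn
  have hn0 : n ≠ 0 := by
    have := H.norm_ne_zero (p := c) (q := 1) (by simp)
    rwa [one_pow, one_mul] at this
  have hsum : (n.roots.map fun a => ptDiv t η a (c.eval a)).sum P =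
      (n.roots.map fun a => if P.Centered t η a (c.eval a) then (1 : ℤ) else 0).sum := by
    change Finsupp.applyAddHom P _ = _
    rw [map_multiset_sum, Multiset.map_map]
    refine congrArg _ (Multiset.map_congr rfl fun a ha => ?_)
    exact H.ptDiv_apply h2 (hc a ha) P
  rw [hsum]
  by_cases hP : ∃ a ∈ n.roots, P.Centered t η a (c.eval a)
  · obtain ⟨a, ha, hP⟩ := hP
    obtain ⟨n₀, h1, h1'⟩ := exists_eq_pow_rootMultiplicity_mul_and_not_dvd n hn0 a
    rw [H.ord_sub_of_centered h2 hP (hc a ha) h1 fun h => h1' (dvd_iff_isRoot.2 h),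
      ← count_roots]
    have : ∀ a' ∈ n.roots, (if P.Centered t η a' (c.eval a') then (1 : ℤ) else 0) =
        if a' = a then 1 else 0 := by
      intro a' _
      refine if_congr ⟨fun h => ?_, ?_⟩ rfl rfl
      · exact P.eq_of_v_sub_lt_one h.1 hP.1
      · rintro rfl; exact hP
    rw [Multiset.map_congr rfl this]
    generalize n.roots = S
    induction S using Multiset.induction_on with
    | empty => simp
    | cons b S ih =>
      rw [Multiset.map_cons, Multiset.sum_cons, ← ih, Multiset.count_cons]
      by_cases hb : b = a
      · subst hb; simp [add_comm]
      · simp [hb, Ne.symm hb]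
  -- If `η - c(t)` vanished at `P`, so would the norm; then `t` would reduce to a root `a`, and `η`
  -- to `c(a)`, against the case assumption.
  · have h0 : P.v (η - aeval t c) = 1 := by
      by_contra hne
      have hle : P.v (η - aeval t c) ≤ 1 :=
        (P.v.map_sub _ _).trans (max_le (H.v_eta_le_one ht) (P.v_aeval_le_one ht c))
      have hlt := lt_of_le_of_ne hle hne
      have hlt' : P.v (aeval t n) < 1 := by
        refine lt_of_le_of_ne (P.v_aeval_le_one ht n) fun h => hne (H.v_sub_eq_one ht h)
      obtain ⟨a, ha, hva⟩ := Place.exists_root_of_v_lt_one hn0 hs hlt'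
      refine hP ⟨a, ha, hva, ?_⟩
      rw [show η - algebraMap L F (c.eval a) =
        (η - aeval t c) + (aeval t c - algebraMap L F (c.eval a)) by ring]
      exact P.v.map_add_lt hlt (P.v_aeval_sub_lt_one hva c)
    push Not at hP
    rw [Place.ord_eq_zero h0, eq_comm]
    refine Multiset.sum_eq_zero ?_
    simp only [Multiset.mem_map]
    rintro _ ⟨a, ha, rfl⟩
    rw [if_neg (hP a ha)]

/-- The model of `F` at infinity. -/
lemma reflect (hg : g.natDegree ≤ 6) :
    IsQuadraticModel t⁻¹ (η * t⁻¹ ^ 3) (g.reflect 6) := by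
  have ht : t ≠ 0 := by simpa using H.sub_ne_zero 0
  have key : ∀ {N : ℕ} {p : L[X]}, p.natDegree ≤ N →
      aeval t⁻¹ (p.reflect N) * t ^ N = aeval t p := fun hp => aeval_inv_reflect_mul_pow ht hp
  have key' : ∀ {N : ℕ} {p : L[X]}, p.natDegree ≤ N →
      aeval t (p.reflect N) = aeval t⁻¹ p * t ^ N := by
    intro N p hp
    have h := key (N := N) (p := p.reflect N) (natDegree_reflect_le.trans (max_le le_rfl hp))
    rw [reflect_reflect] at h
    exact h.symm
  refine ⟨?_, fun p q h => ?_, fun z => ?_⟩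
  · have h1 := key hg
    rw [← H.sq] at h1
    have h2 : t⁻¹ ^ 6 * t ^ 6 = 1 := by rw [← mul_pow, inv_mul_cancel₀ ht, one_pow]
    linear_combination (-t⁻¹ ^ 6) * h1 + aeval t⁻¹ (g.reflect 6) * h2
  · set N := max p.natDegree q.natDegree
    have h1 := key' (N := N) (p := p) (le_max_left _ _)
    have h2 := key' (N := N) (p := q) (le_max_right _ _)
    -- The relation in `1/t` is multiplied by `t ^ (N + 3)` to become a polynomial relation in `t`
    -- and `η`.
    have h3 := H.indep (p.reflect N * X ^ 3) (q.reflect N) (by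
      rw [map_mul, h1, h2, map_pow, aeval_X]
      field_simp at h ⊢
      linear_combination t ^ N * h)
    have h4 : p.reflect N = 0 := by simpa using h3.1
    exact ⟨(reflect_eq_zero_iff).1 h4, (reflect_eq_zero_iff).1 h3.2⟩
  · obtain ⟨p, q, r, hr, h⟩ := H.gen z
    set N := max p.natDegree (max q.natDegree r.natDegree)
    have h1 := key (N := N + 3) (p := p) (by omega)
    have h2 := key (N := N) (p := q) (by omega)
    have h3 := key (N := N + 3) (p := r) (by omega)
    refine ⟨p.reflect (N + 3), q.reflect N, r.reflect (N + 3),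
      fun h' => hr ((reflect_eq_zero_iff).1 h'), ?_⟩
    rw [← h1, ← h2, ← h3] at h
    refine mul_right_cancel₀ (pow_ne_zero (N + 3) ht) ?_
    have h4 : t⁻¹ ^ 3 * t ^ 3 = 1 := by rw [← mul_pow, inv_mul_cancel₀ ht, one_pow]
    linear_combination h - aeval t⁻¹ (q.reflect N) * t ^ N * η * h4

lemma centered_or_centered_neg {P : Place L F} {a e : L} (he : e ^ 2 = g.eval a)
    (ha : P.v (t - algebraMap L F a) < 1) :
    P.Centered t η a e ∨ P.Centered t η a (-e) := by
  have h := P.v_aeval_sub_lt_one ha g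
  rw [← H.sq, ← he, map_pow, sq_sub_sq, map_mul] at h
  by_contra! hcon
  have h1 : 1 ≤ P.v (η - algebraMap L F e) := not_lt.1 fun h => hcon.1 ⟨ha, h⟩
  have h2 : 1 ≤ P.v (η + algebraMap L F e) := not_lt.1 fun h => hcon.2 ⟨ha, by
    rwa [map_neg, sub_neg_eq_add]⟩
  exact absurd h (not_lt.2 (one_le_mul h2 h1))

omit H in
lemma _root_.Place.Centered.eq_right {P : Place L F} {a b a' b' : L} (h : P.Centered t η a b)
    (h' : P.Centered t η a' b') : b = b' := P.eq_of_v_sub_lt_one h.2 h'.2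

end IsQuadraticModel

/-- The places at infinity. -/
noncomputable def infPt (t η : F) (μ : L) : Divisor L F := ptDiv t⁻¹ (η * t⁻¹ ^ 3) 0 μ

lemma Place.v_aeval_of_one_lt {P : Place L F} {t : F} (ht : 1 < P.v t) {p : L[X]} (hp : p ≠ 0) :
    P.v (aeval t p) = P.v t ^ p.natDegree := by
  have ht0 : t ≠ 0 := by
    rintro rfl
    simp at ht
  let _ := invertibleOfNonzero ht0
  have h := eval₂_reverse_mul_pow (algebraMap L F) t p
  rw [invOf_eq_inv] at h
  change aeval t⁻¹ p.reverse * _ = aeval t p at h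
  rw [← h, map_mul, map_pow]
  have h1 : P.v (t⁻¹ - algebraMap L F 0) < 1 := by
    rw [map_zero, sub_zero, map_inv₀]
    exact inv_lt_one_of_one_lt₀ ht
  rw [P.v_eq_one_of_v_sub_lt_one (c := p.reverse.eval 0) ?_ (P.v_aeval_sub_lt_one h1 _), one_mul]
  rw [← coeff_zero_eq_eval_zero, coeff_zero_reverse]
  exact leadingCoeff_ne_zero.2 hp

/-! ### Orders at the places at infinity -/

namespace IsQuadraticModel

variable {t η : F} {g : L[X]} (H : IsQuadraticModel t η g) (hg : g.natDegree ≤ 6)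
include H

omit H in
lemma eval_zero_reflect (N : ℕ) (p : L[X]) : (p.reflect N).eval 0 = p.coeff N := by
  rw [← coeff_zero_eq_eval_zero, coeff_reflect, revAt_zero]

omit H in
lemma v_inv_lt_one {P : Place L F} (hP : 1 < P.v t) : P.v (t⁻¹ - algebraMap L F 0) < 1 := by
  rw [map_zero, sub_zero, map_inv₀]
  exact inv_lt_one_of_one_lt₀ hP

include hg

lemma exists_centered_infinity {P : Place L F} {e : L} (he : e ^ 2 = g.coeff 6)
    (hP : 1 < P.v t) :
    P.Centered t⁻¹ (η * t⁻¹ ^ 3) 0 e ∨ P.Centered t⁻¹ (η * t⁻¹ ^ 3) 0 (-e) :=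
  (H.reflect hg).centered_or_centered_neg (by rw [eval_zero_reflect, he]) (v_inv_lt_one hP)

/-- The leading coefficient of `g` is a nonzero square, so the reflected model has the rational
points `(0, ±e)` with `±e ≠ 0`, where `1/t` is a uniformiser. -/
lemma v_infinity (h2 : (2 : L) ≠ 0) {e : L} (he : e ^ 2 = g.coeff 6) (he0 : e ≠ 0)
    {P : Place L F} (hP : 1 < P.v t) : P.v t = WithZero.exp 1 := by
  have : P.v t⁻¹ = WithZero.exp (-1) := by
    rcases H.exists_centered_infinity hg he hP with h | h
    · have := (H.reflect hg).v_uniformizer he0 ((H.reflect hg).eval_eq_of_centered h) h2 h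
      simpa using this
    · have := (H.reflect hg).v_uniformizer (neg_ne_zero.2 he0)
        ((H.reflect hg).eval_eq_of_centered h) h2 h
      simpa using this
  rw [map_inv₀] at this
  rw [← inv_inv (P.v t), this, ← WithZero.exp_neg, neg_neg]

lemma v_eta_infinity {e : L} (he : e ^ 2 = g.coeff 6) (he0 : e ≠ 0)
    {P : Place L F} (hP : 1 < P.v t) : P.v η = P.v t ^ 3 := by
  have ht : P.v t ≠ 0 := (zero_lt_one.trans hP).ne'
  have : P.v (η * t⁻¹ ^ 3) = 1 := by
    rcases H.exists_centered_infinity hg he hP with h | h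
    · exact P.v_eq_one_of_v_sub_lt_one he0 h.2
    · exact P.v_eq_one_of_v_sub_lt_one (neg_ne_zero.2 he0) h.2
  rw [map_mul, map_pow, map_inv₀] at this
  field_simp at this
  exact this

/-- Write `η - c(t) = t³ (η' - c'(1/t))`. The first factor contributes `-3`. The norm of the second
is `(1/t) ^ (6 - deg (c² - g))` times a unit, and this power counts exactly at the place where `η'`
takes the value `c'(0)`, the cubic coefficient of `c`. -/
lemma ord_sub_infinity (h2 : (2 : L) ≠ 0) {e : L} (he : e ^ 2 = g.coeff 6) (he0 : e ≠ 0)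
    {P : Place L F} (hP : 1 < P.v t) {c : L[X]} (hc : c.natDegree ≤ 3) :
    P.ord (η - aeval t c) =
      (6 - (c ^ 2 - g).natDegree : ℕ) * infPt t η (c.coeff 3) P - 3 := by
  classical
  have H' := H.reflect hg
  have ht : t ≠ 0 := by simpa using H.sub_ne_zero 0
  have hn0 : c ^ 2 - g ≠ 0 := by
    have := H.norm_ne_zero (p := c) (q := 1) (by simp)
    rwa [one_pow, one_mul] at this
  have hd : (c ^ 2 - g).natDegree ≤ 6 :=
    (natDegree_sub_le _ _).trans (max_le (natDegree_pow_le.trans (by omega)) hg)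
  have hord_t : P.ord t = -1 := P.ord_of_v_eq_exp (H.v_infinity hg h2 he he0 hP)
  set η' := η * t⁻¹ ^ 3 with hη'
  set c' := c.reflect 3 with hc'
  have hcc : aeval t⁻¹ c' * t ^ 3 = aeval t c := aeval_inv_reflect_mul_pow ht hc
  have hfac : η - aeval t c = t ^ 3 * (η' - aeval t⁻¹ c') := by
    have h4 : t⁻¹ ^ 3 * t ^ 3 = 1 := by rw [← mul_pow, inv_mul_cancel₀ ht, one_pow]
    rw [← hcc, hη']
    linear_combination -η * h4
  have hne : η' - aeval t⁻¹ c' ≠ 0 := by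
    intro h
    have := H'.indep (-c') 1 (by simp only [map_neg, map_one]; linear_combination h)
    exact one_ne_zero this.2
  have hn' : c' ^ 2 - g.reflect 6 = (X - C 0) ^ (6 - (c ^ 2 - g).natDegree) *
      (c ^ 2 - g).reverse := by
    rw [hc', pow_two, ← reflect_mul c c hc hc, ← reflect_sub, ← pow_two]
    have := reflect_mul (1 : L[X]) (c ^ 2 - g) (F := 6 - (c ^ 2 - g).natDegree)
      (G := (c ^ 2 - g).natDegree) (by simp) le_rfl
    rw [one_mul, Nat.sub_add_cancel hd, reflect_one] at this
    rw [C_0, sub_zero, this]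
    rfl
  have hn₀ : (c ^ 2 - g).reverse.eval 0 ≠ 0 := by
    rw [← coeff_zero_eq_eval_zero, coeff_zero_reverse]
    exact leadingCoeff_ne_zero.2 hn0
  have hc0 : c'.eval 0 = c.coeff 3 := eval_zero_reflect _ _
  have key : P.ord (η' - aeval t⁻¹ c') =
      (6 - (c ^ 2 - g).natDegree : ℕ) * infPt t η (c.coeff 3) P := by
    obtain ⟨μ, hμ0, hμ⟩ : ∃ μ : L, μ ≠ 0 ∧ P.Centered t⁻¹ η' 0 μ := by
      rcases H.exists_centered_infinity hg he hP with h | h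
      · exact ⟨e, he0, h⟩
      · exact ⟨-e, neg_ne_zero.2 he0, h⟩
    by_cases hμc : μ = c.coeff 3
    · rw [hμc, ← hc0] at hμ
      rw [hμc, ← hc0] at hμ0
      rw [H'.ord_sub_of_centered h2 hμ hμ0 hn' hn₀, infPt, ← hc0, H'.ptDiv_apply h2 hμ0, if_pos hμ,
        mul_one]
    · have h0 : infPt t η (c.coeff 3) P = 0 := by
        -- For cubic coefficient zero no place at infinity lies over it, because `g` has degree six;
        -- the default value of `ptDiv` is then the right one.
        by_cases h30 : c.coeff 3 = 0
        · rw [infPt, ptDiv, dif_neg, Finsupp.zero_apply]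
          rintro ⟨Q, hQ⟩
          have := H'.eval_eq_of_centered hQ
          rw [eval_zero_reflect, ← he, h30] at this
          exact he0 (by simpa using this.symm)
        · rw [infPt, H'.ptDiv_apply h2 h30, if_neg]
          exact fun h => hμc (hμ.eq_right h)
      rw [h0, mul_zero]
      refine Place.ord_eq_zero (P.v_eq_one_of_v_sub_lt_one (c := μ - c.coeff 3)
        (_root_.sub_ne_zero.2 hμc) ?_)
      rw [← hc0, map_sub (algebraMap L F), sub_sub_sub_comm]
      exact (P.v.map_sub _ _).trans_lt (max_lt hμ.2 (P.v_aeval_sub_lt_one hμ.1 c'))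
  rw [hfac, P.ord_mul (pow_ne_zero 3 ht) hne, key, pow_succ, pow_two, P.ord_mul (mul_ne_zero ht ht) ht,
    P.ord_mul ht ht, hord_t]
  ring

omit hg in
lemma infPt_apply_of_v_le_one {P : Place L F} (hP : P.v t ≤ 1) (μ : L) :
    infPt t η μ P = 0 := by
  classical
  have hnot : ¬ P.Centered t⁻¹ (η * t⁻¹ ^ 3) 0 μ := by
    intro h
    have := h.1
    rw [map_zero, sub_zero, map_inv₀] at this
    exact absurd this (not_lt.2 ((one_le_inv₀ (zero_lt_iff.2 ((Valuation.ne_zero_iff _).2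
      (by simpa using H.sub_ne_zero 0)))).2 hP))
  rw [infPt, ptDiv]
  split_ifs with h
  · rw [Finsupp.single_apply, if_neg]
    rintro rfl
    exact hnot h.choose_spec
  · rfl

omit H hg in
lemma ptDiv_apply_of_one_lt {P : Place L F} (hP : 1 < P.v t) (a b : L) :
    ptDiv t η a b P = 0 := by
  classical
  rw [ptDiv]
  split_ifs with h
  · rw [Finsupp.single_apply, if_neg]
    rintro rfl
    exact absurd (Place.v_le_one_of_v_sub_lt_one _ h.choose_spec.1) (not_le.2 hP)
  · rfl

lemma infPt_add_infPt_neg_apply (h2 : (2 : L) ≠ 0) {e : L} (he : e ^ 2 = g.coeff 6)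
    (he0 : e ≠ 0) {P : Place L F} (hP : 1 < P.v t) : (infPt t η e + infPt t η (-e)) P = 1 := by
  classical
  have H' := H.reflect hg
  have hne : e ≠ -e := by
    intro h
    have : 2 * e = 0 := by linear_combination h
    exact he0 ((mul_eq_zero.1 this).resolve_left h2)
  rw [Finsupp.add_apply, infPt, infPt, H'.ptDiv_apply h2 he0,
    H'.ptDiv_apply h2 (neg_ne_zero.2 he0)]
  rcases H.exists_centered_infinity hg he hP with h | h
  · rw [if_pos h, if_neg fun h' => hne (h.eq_right h'), add_zero]
  · rw [if_pos h, if_neg fun h' => hne (h'.eq_right h), zero_add]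

end IsQuadraticModel

/-- The sum of the points `(a, c(a))` for `a` in a multiset `S`. -/
noncomputable def affDiv (t η : F) (S : Multiset L) (c : L[X]) : Divisor L F :=
  (S.map fun a => ptDiv t η a (c.eval a)).sum

namespace IsQuadraticModel

variable {t η : F} {g : L[X]} (H : IsQuadraticModel t η g) (hg : g.natDegree ≤ 6)
include H hg

omit H hg in
lemma affDiv_apply_of_one_lt {P : Place L F} (hP : 1 < P.v t) (S : Multiset L) (c : L[X]) :
    affDiv t η S c P = 0 := by
  change Finsupp.applyAddHom P _ = _
  rw [affDiv, map_multiset_sum, Multiset.map_map]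
  refine Multiset.sum_eq_zero ?_
  simp only [Multiset.mem_map]
  rintro _ ⟨a, -, rfl⟩
  exact ptDiv_apply_of_one_lt hP _ _

/-- The divisor of `η - c(t)` when `c` has degree at most three. -/
theorem ord_sub (h2 : (2 : L) ≠ 0) {e : L} (he : e ^ 2 = g.coeff 6) (he0 : e ≠ 0)
    {c : L[X]} (hc3 : c.natDegree ≤ 3) (hs : (c ^ 2 - g).Splits)
    (hc : ∀ a ∈ (c ^ 2 - g).roots, c.eval a ≠ 0) (P : Place L F) :
    (affDiv t η (c ^ 2 - g).roots c + (6 - (c ^ 2 - g).natDegree) • infPt t η (c.coeff 3) -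
      3 • (infPt t η e + infPt t η (-e))) P = P.ord (η - aeval t c) := by
  rcases le_or_gt (P.v t) 1 with hP | hP
  · rw [H.ord_sub_of_v_le_one h2 hP hs hc]
    simp [H.infPt_apply_of_v_le_one hP, affDiv]
  · have := H.infPt_add_infPt_neg_apply hg h2 he he0 hP
    rw [H.ord_sub_infinity hg h2 he he0 hP hc3, Finsupp.sub_apply, Finsupp.add_apply,
      affDiv_apply_of_one_lt hP, Finsupp.smul_apply, Finsupp.smul_apply, this]
    simp

/-- The divisor of `η - c(t)` when `c` has degree four. -/
theorem ord_sub_of_natDegree_eq_four (h2 : (2 : L) ≠ 0) {e : L} (he : e ^ 2 = g.coeff 6)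
    (he0 : e ≠ 0) {c : L[X]} (hc4 : c.natDegree = 4) (hs : (c ^ 2 - g).Splits)
    (hc : ∀ a ∈ (c ^ 2 - g).roots, c.eval a ≠ 0) (P : Place L F) :
    (affDiv t η (c ^ 2 - g).roots c - 4 • (infPt t η e + infPt t η (-e))) P =
      P.ord (η - aeval t c) := by
  rcases le_or_gt (P.v t) 1 with hP | hP
  · rw [H.ord_sub_of_v_le_one h2 hP hs hc]
    simp [H.infPt_apply_of_v_le_one hP, affDiv]
  · have := H.infPt_add_infPt_neg_apply hg h2 he he0 hP
    rw [Finsupp.sub_apply, affDiv_apply_of_one_lt hP, Finsupp.smul_apply, this]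
    have hv := H.v_infinity hg h2 he he0 hP
    have hc0 : c ≠ 0 := by
      rintro rfl
      simp at hc4
    have hvc := P.v_aeval_of_one_lt hP hc0
    -- A quartic has a pole of order four at infinity, which dominates the pole of order three of
    -- `η`.
    have hlt : P.v η < P.v (aeval t c) := by
      rw [H.v_eta_infinity hg he he0 hP, hvc, hc4]
      exact pow_lt_pow_right₀ hP (by norm_num)
    have : P.v (η - aeval t c) = WithZero.exp 4 := by
      rw [Valuation.map_sub_eq_of_lt_right _ hlt, hvc, hc4, hv,
        ← WithZero.exp_nsmul]
      rfl
    rw [P.ord_of_v_eq_exp this]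
    rfl

end IsQuadraticModel

end PointDivisor

/-! ### The coordinate ring of a sextic curve is a Dedekind domain -/

/-- After cancelling the gcd, the square of the remaining factor of `r` is prime to the cofactor of
`q` and divides `g`, so that factor is a unit. -/
lemma dvd_of_sq_dvd_sq_mul_squarefree {L : Type*} [Field L] {r q g : L[X]} (hg : Squarefree g)
    (hr : r ≠ 0) (h : r ^ 2 ∣ q ^ 2 * g) : r ∣ q := by
  classical
  let _ : GCDMonoid L[X] := UniqueFactorizationMonoid.toGCDMonoid _
  obtain ⟨r', q', h1, h2, hu⟩ := extract_gcd r q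
  set δ := gcd r q
  have hδ : δ ≠ 0 := fun h0 => hr (by rw [h1, h0, zero_mul])
  rw [h1, h2, mul_pow, mul_pow, mul_assoc, mul_dvd_mul_iff_left (pow_ne_zero 2 hδ)] at h
  have hcop : IsRelPrime r' q' := gcd_isUnit_iff_isRelPrime.1 hu
  have hdvd : r' ^ 2 ∣ g := (hcop.pow (m := 2) (n := 2)).dvd_of_dvd_mul_left h
  rw [h1, h2]
  exact mul_dvd_mul_left _ (hg r' (by rwa [← pow_two])).dvd

namespace SexticCurve

variable {L : Type*} [Field L] (C : SexticCurve L)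

/-- The polynomial `f / d`. -/
noncomputable def g : L[X] := Polynomial.C C.d⁻¹ * C.f

/-- The coordinate function `x`. -/
noncomputable def x : C.FunctionField :=
  algebraMap C.CoordinateRing C.FunctionField (AdjoinRoot.of C.polynomial X)

/-- The coordinate function `y`. -/
noncomputable def y : C.FunctionField :=
  algebraMap C.CoordinateRing C.FunctionField (AdjoinRoot.root C.polynomial)

lemma natDegree_g : C.g.natDegree = 6 := by
  rw [g, natDegree_C_mul (inv_ne_zero C.d_ne), C.natDegree_f]

lemma separable_g : C.g.Separable :=
  C.separable_f.unit_mul (isUnit_C.2 (inv_ne_zero C.d_ne).isUnit)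

lemma monic_polynomial : C.polynomial.Monic := monic_X_pow_sub_C _ two_ne_zero

lemma natDegree_polynomial : C.polynomial.natDegree = 2 := natDegree_X_pow_sub_C

lemma root_sq : AdjoinRoot.root C.polynomial ^ 2 = AdjoinRoot.of C.polynomial C.g := by
  have := AdjoinRoot.eval₂_root C.polynomial
  rw [polynomial, eval₂_sub, eval₂_X_pow, eval₂_C, sub_eq_zero] at this
  exact this

lemma algebraMap_eq_aeval (p : L[X]) : algebraMap L[X] C.FunctionField p = aeval C.x p := by
  have : (IsScalarTower.toAlgHom L L[X] C.FunctionField) = aeval C.x := by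
    ext
    simp only [IsScalarTower.coe_toAlgHom', aeval_X, x]
    rw [IsScalarTower.algebraMap_apply L[X] C.CoordinateRing C.FunctionField,
      AdjoinRoot.algebraMap_eq]
  exact congrArg (fun φ => φ p) this

lemma algebraMap_of (p : L[X]) :
    algebraMap C.CoordinateRing C.FunctionField (AdjoinRoot.of C.polynomial p) = aeval C.x p := by
  rw [← C.algebraMap_eq_aeval, IsScalarTower.algebraMap_apply L[X] C.CoordinateRing
    C.FunctionField, AdjoinRoot.algebraMap_eq]

lemma exists_eq_of_add_of_mul_root (r : C.CoordinateRing) : ∃ p q : L[X],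
    r = AdjoinRoot.of C.polynomial p + AdjoinRoot.of C.polynomial q * AdjoinRoot.root _ := by
  obtain ⟨f, rfl⟩ := AdjoinRoot.mk_surjective r
  have h1 : AdjoinRoot.mk C.polynomial f = AdjoinRoot.mk C.polynomial (f %ₘ C.polynomial) := by
    conv_lhs => rw [← modByMonic_add_div f C.polynomial]
    simp
  have hdeg : (f %ₘ C.polynomial).natDegree < 2 := by
    have := natDegree_modByMonic_lt f C.monic_polynomial (by
      intro h
      have := C.natDegree_polynomial
      rw [h] at this
      simp at this)
    rwa [C.natDegree_polynomial] at this
  refine ⟨(f %ₘ C.polynomial).coeff 0, (f %ₘ C.polynomial).coeff 1, ?_⟩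
  rw [h1]
  conv_lhs => rw [eq_X_add_C_of_natDegree_le_one (Nat.le_of_lt_succ hdeg)]
  simp [add_comm]

lemma algebraMap_of_add_of_mul_root (p q : L[X]) :
    algebraMap C.CoordinateRing C.FunctionField (AdjoinRoot.of C.polynomial p +
      AdjoinRoot.of C.polynomial q * AdjoinRoot.root _) = aeval C.x p + aeval C.x q * C.y := by
  rw [map_add, map_mul, algebraMap_of, algebraMap_of, y]

lemma exists_algebraMap_eq (r : C.CoordinateRing) : ∃ p q : L[X],
    algebraMap C.CoordinateRing C.FunctionField r = aeval C.x p + aeval C.x q * C.y := by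
  obtain ⟨p, q, rfl⟩ := C.exists_eq_of_add_of_mul_root r
  exact ⟨p, q, C.algebraMap_of_add_of_mul_root p q⟩

lemma of_injective : ∀ p q : L[X], aeval C.x p + aeval C.x q * C.y = 0 → p = 0 ∧ q = 0 := by
  intro p q h
  rw [← algebraMap_of, ← algebraMap_of, y, ← map_mul, ← map_add] at h
  have h0 := (FaithfulSMul.algebraMap_eq_zero_iff C.CoordinateRing C.FunctionField).1 h
  have h1 : AdjoinRoot.mk C.polynomial (Polynomial.C p + Polynomial.C q * X) = 0 := by
    simpa using h0
  rw [AdjoinRoot.mk_eq_zero] at h1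
  have h2 : Polynomial.C p + Polynomial.C q * X = 0 := by
    by_contra hne
    have := natDegree_le_of_dvd h1 hne
    rw [C.natDegree_polynomial] at this
    have h3 : (Polynomial.C p + Polynomial.C q * X : L[X][X]).natDegree ≤ 1 := by
      rw [add_comm]; exact natDegree_linear_le
    omega
  have hp := congrArg (fun f => f.coeff 0) h2
  have hq := congrArg (fun f => f.coeff 1) h2
  simp at hp hq
  exact ⟨hp, hq⟩

lemma isQuadraticModel : IsQuadraticModel C.x C.y C.g := by
  have hsq : C.y ^ 2 = aeval C.x C.g := by
    rw [y, ← map_pow, C.root_sq, algebraMap_of]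
  refine ⟨hsq, C.of_injective, fun z => ?_⟩
  obtain ⟨r, s, hs, rfl⟩ := IsFractionRing.div_surjective (A := C.CoordinateRing) z
  obtain ⟨p, q, e1⟩ := C.exists_algebraMap_eq r
  obtain ⟨p', q', e2⟩ := C.exists_algebraMap_eq s
  have hs0 : algebraMap C.CoordinateRing C.FunctionField s ≠ 0 :=
    IsFractionRing.to_map_ne_zero_of_mem_nonZeroDivisors hs
  have hconj : aeval C.x p' - aeval C.x q' * C.y ≠ 0 := by
    intro h
    have := C.of_injective p' (-q') (by rw [map_neg]; linear_combination h)
    rw [e2, this.1, neg_eq_zero.1 this.2] at hs0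
    simp at hs0
  have hN : (aeval C.x p' + aeval C.x q' * C.y) * (aeval C.x p' - aeval C.x q' * C.y) =
      aeval C.x (p' ^ 2 - q' ^ 2 * C.g) := by
    simp only [map_sub, map_mul, map_pow, ← hsq]; ring
  refine ⟨p * p' - q * q' * C.g, q * p' - p * q', p' ^ 2 - q' ^ 2 * C.g, ?_, ?_⟩
  · intro h
    rw [h, map_zero] at hN
    exact mul_ne_zero (e2 ▸ hs0) hconj hN
  · rw [e1, e2, ← hN]
    rw [e2] at hs0
    rw [← mul_assoc, div_mul_cancel₀ _ hs0]
    simp only [map_sub, map_mul, ← hsq]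
    ring

/-- The endomorphism `y ↦ -y` of the function field. -/
lemma exists_conj : ∃ τ : C.FunctionField →ₐ[L[X]] C.FunctionField, τ C.y = -C.y := by
  have h : ∀ f : L[X][X], f = X ^ 2 - Polynomial.C C.g →
      f.eval₂ (Algebra.ofId L[X] C.FunctionField : L[X] →+* C.FunctionField) (-C.y) = 0 := by
    rintro _ rfl
    rw [eval₂_sub, eval₂_X_pow, eval₂_C, neg_sq, C.isQuadraticModel.sq]
    change _ - algebraMap L[X] C.FunctionField C.g = 0
    rw [algebraMap_eq_aeval, sub_self]
  let ψ : C.CoordinateRing →ₐ[L[X]] C.FunctionField :=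
    AdjoinRoot.liftAlgHom C.polynomial (Algebra.ofId L[X] C.FunctionField) (-C.y)
      (h _ rfl)
  have hψ : ∀ r : C.CoordinateRing, ψ r = 0 → r = 0 := by
    intro r hr
    obtain ⟨p, q, rfl⟩ := C.exists_eq_of_add_of_mul_root r
    have h1 : ∀ p : L[X], ψ (AdjoinRoot.of C.polynomial p) = aeval C.x p := by
      intro p
      rw [← C.algebraMap_eq_aeval]
      exact AdjoinRoot.liftAlgHom_of ..
    have h2 : ψ (AdjoinRoot.root _) = -C.y := AdjoinRoot.liftAlgHom_root ..
    rw [map_add, map_mul, h1, h1, h2] at hr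
    obtain ⟨hp, hq⟩ := C.of_injective p (-q) (by rw [map_neg]; linear_combination hr)
    rw [hp, neg_eq_zero.1 hq]
    simp
  have hinj : Function.Injective ψ := (injective_iff_map_eq_zero ψ).2 hψ
  refine ⟨IsFractionRing.liftAlgHom (K := C.FunctionField) hinj, ?_⟩
  rw [y, IsFractionRing.coe_liftAlgHom]
  refine (IsFractionRing.lift_algebraMap _ _).trans ?_
  exact AdjoinRoot.liftAlgHom_root ..

lemma exists_eq_of_isIntegral {w : C.FunctionField} (hw : IsIntegral L[X] w) {r p : L[X]}
    (hr : r ≠ 0) (h : w * aeval C.x r = aeval C.x p) : ∃ p' : L[X], w = aeval C.x p' := by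
  have hinj : Function.Injective (algebraMap L[X] C.FunctionField) := by
    rw [injective_iff_map_eq_zero]
    intro p hp
    rw [algebraMap_eq_aeval] at hp
    exact C.isQuadraticModel.aeval_eq_zero hp
  let φ : FractionRing L[X] →ₐ[L[X]] C.FunctionField :=
    IsFractionRing.liftAlgHom (g := Algebra.ofId L[X] C.FunctionField) hinj
  have hr0 := C.isQuadraticModel.aeval_ne_zero hr
  have hwφ : w = φ (algebraMap _ _ p / algebraMap _ _ r) := by
    rw [map_div₀, AlgHom.commutes, AlgHom.commutes, algebraMap_eq_aeval, algebraMap_eq_aeval, ← h]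
    field_simp
  rw [hwφ] at hw ⊢
  have := (isIntegral_algHom_iff φ φ.toRingHom.injective).1 hw
  obtain ⟨p', hp'⟩ := IsIntegrallyClosed.isIntegral_iff.1 this
  refine ⟨p', ?_⟩
  rw [← hp', AlgHom.commutes, algebraMap_eq_aeval]

/-- For `z = (p + q y) / r` the trace `P₁ = 2p / r` and the norm `P₂ = (p² - q² g) / r²` are
integral, hence polynomials. So `r²` divides `(2q)² g`, the quotient being `P₁² - 4P₂`. As `g` is
squarefree, `r` divides `2q`, and `2` is invertible. -/
lemma exists_algebraMap_eq_of_isIntegral {z : C.FunctionField} (hz : IsIntegral L[X] z) :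
    ∃ r : C.CoordinateRing, algebraMap C.CoordinateRing C.FunctionField r = z := by
  obtain ⟨τ, hτ⟩ := C.exists_conj
  obtain ⟨p, q, r, hr, h⟩ := C.isQuadraticModel.gen z
  have hτx : ∀ p : L[X], τ (aeval C.x p) = aeval C.x p := by
    intro p
    rw [← C.algebraMap_eq_aeval, AlgHom.commutes]
  have h' := congrArg τ h
  rw [map_mul, map_add, map_mul, hτx, hτx, hτx, hτ] at h'
  have hsq := C.isQuadraticModel.sq
  have hr0 := C.isQuadraticModel.aeval_ne_zero hr
  have hτz : IsIntegral L[X] (τ z) := hz.map τ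
  obtain ⟨P₁, hP₁⟩ := C.exists_eq_of_isIntegral (hz.add hτz) (r := r) (p := 2 * p) hr (by
    rw [map_mul, map_ofNat]; linear_combination h + h')
  obtain ⟨P₂, hP₂⟩ := C.exists_eq_of_isIntegral (hz.mul hτz) (r := r ^ 2)
    (p := p ^ 2 - q ^ 2 * C.g) (pow_ne_zero 2 hr) (by
    rw [map_sub, map_mul, map_pow, map_pow, map_pow, ← hsq]
    linear_combination (aeval C.x r * τ z) * h + (aeval C.x p + aeval C.x q * C.y) * h')
  have hdvd : r ^ 2 ∣ (2 * q) ^ 2 * C.g := by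
    refine ⟨P₁ ^ 2 - 4 * P₂, ?_⟩
    have : aeval C.x ((2 * q) ^ 2 * C.g - r ^ 2 * (P₁ ^ 2 - 4 * P₂)) = 0 := by
      simp only [map_sub, map_mul, map_pow, map_ofNat, ← hP₁, ← hP₂, ← hsq]
      linear_combination (-(aeval C.x r * (z - τ z) + 2 * aeval C.x q * C.y)) * (h - h')
    exact sub_eq_zero.1 (C.isQuadraticModel.aeval_eq_zero this)
  obtain ⟨q₁, hq₁⟩ := dvd_of_sq_dvd_sq_mul_squarefree C.separable_g.squarefree hr hdvd
  have h2 : (algebraMap L C.FunctionField 2⁻¹) * 2 = 1 := by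
    rw [← map_ofNat (algebraMap L C.FunctionField) 2, ← map_mul, inv_mul_cancel₀ C.two_ne, map_one]
  refine ⟨AdjoinRoot.of _ (Polynomial.C 2⁻¹ * P₁) +
    AdjoinRoot.of _ (Polynomial.C 2⁻¹ * q₁) * AdjoinRoot.root _, ?_⟩
  have hq₂ := congrArg (aeval C.x) hq₁
  rw [map_mul, map_mul, map_ofNat] at hq₂
  have hd : z - τ z = aeval C.x q₁ * C.y := by
    refine mul_left_cancel₀ hr0 ?_
    linear_combination h - h' + C.y * hq₂
  rw [algebraMap_of_add_of_mul_root, map_mul, map_mul, aeval_C, ← hP₁]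
  linear_combination (-algebraMap L C.FunctionField 2⁻¹) * hd + z * h2

instance : IsDedekindDomain C.CoordinateRing := by
  have : Module.Finite L[X] C.CoordinateRing := C.monic_polynomial.finite_adjoinRoot
  refine (isDedekindDomain_iff C.CoordinateRing C.FunctionField).2
    ⟨inferInstance, inferInstance, Ring.DimensionLEOne.of_isIntegral L[X] _, fun {z} hz => ?_⟩
  exact C.exists_algebraMap_eq_of_isIntegral (isIntegral_trans z hz)

/-- The place of the function field attached to a maximal ideal of the coordinate ring. -/
noncomputable def placeOfHeightOne (v : IsDedekindDomain.HeightOneSpectrum C.CoordinateRing) :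
    Place L C.FunctionField where
  v := v.valuation C.FunctionField
  surjective := v.valuation_surjective C.FunctionField
  trivial_on := fun c hc => by
    have h : ∀ c : L, v.valuation C.FunctionField (algebraMap L C.FunctionField c) ≤ 1 := by
      intro c
      rw [IsScalarTower.algebraMap_apply L C.CoordinateRing C.FunctionField]
      exact v.valuation_le_one _
    refine le_antisymm (h c) ?_
    have h1 := h c⁻¹
    rw [map_inv₀, map_inv₀] at h1
    exact (inv_le_one₀ (zero_lt_iff.2 ((Valuation.ne_zero_iff _).2 (by simpa using hc)))).1 h1

/-- A function without poles at the affine places is a polynomial in `x` and `y`. -/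
lemma exists_eq_of_forall_v_le_one {z : C.FunctionField}
    (h : ∀ P : Place L C.FunctionField, P.v C.x ≤ 1 → P.v z ≤ 1) :
    ∃ p q : L[X], z = aeval C.x p + aeval C.x q * C.y := by
  obtain ⟨r, rfl⟩ := IsDedekindDomain.HeightOneSpectrum.mem_integers_of_valuation_le_one
    C.FunctionField z fun v => h (C.placeOfHeightOne v) (v.valuation_le_one _)
  exact C.exists_algebraMap_eq r

end SexticCurve

/-! ### Divisors that are not principal -/

namespace IsQuadraticModel

variable {L F : Type*} [Field L] [Field F] [Algebra L F] {t η : F} {g : L[X]}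
  (H : IsQuadraticModel t η g)
include H

/-- `t - a` is a uniformiser at both conjugate points, and the cofactor of its power in a polynomial
in `t` is a unit at both. -/
lemma v_aeval_eq_of_centered_neg (h2 : (2 : L) ≠ 0) {P Q : Place L F} {a b : L} (hb : b ≠ 0)
    (hP : P.Centered t η a b) (hQ : Q.Centered t η a (-b)) (p : L[X]) :
    P.v (aeval t p) = Q.v (aeval t p) := by
  by_cases hp : p = 0
  · simp [hp]
  obtain ⟨p₀, h1, h1'⟩ := exists_eq_pow_rootMultiplicity_mul_and_not_dvd p hp a
  have h0 : p₀.eval a ≠ 0 := fun h => h1' (dvd_iff_isRoot.2 h)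
  have e1 : P.v (aeval t p₀) = 1 := hP.v_eq_one ⟨p₀, 0, by simp, by simpa using h0⟩
  have e2 : Q.v (aeval t p₀) = 1 := hQ.v_eq_one ⟨p₀, 0, by simp, by simpa using h0⟩
  have e3 := H.v_uniformizer hb (H.eval_eq_of_centered hP) h2 hP
  have e4 := H.v_uniformizer (neg_ne_zero.2 hb) (H.eval_eq_of_centered hQ) h2 hQ
  rw [h1, map_mul, map_pow, map_mul, map_mul, e1, e2, map_pow, map_pow,
    show aeval t (X - C a) = t - algebraMap L F a by simp, e3, e4]

/-- A polynomial in `t` and `η` whose pole order is at most two at infinity is a polynomial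
in `t`. -/
lemma eq_zero_of_v_le_sq (hg : g.natDegree ≤ 6) (h2 : (2 : L) ≠ 0) {e : L}
    (he : e ^ 2 = g.coeff 6) (he0 : e ≠ 0) {p q : L[X]}
    (h : ∀ P : Place L F, 1 < P.v t → P.v (aeval t p + aeval t q * η) ≤ P.v t ^ 2) : q = 0 := by
  by_contra hq
  have ht : t ≠ 0 := by simpa using H.sub_ne_zero 0
  -- `N` bounds the pole order of `p(t) + q(t) η` at infinity, `t` having order `-1` and `η` order
  -- `-3`.
  set N := max p.natDegree (q.natDegree + 3) with hN
  obtain ⟨M, hM⟩ : ∃ M, N = M + 3 := ⟨N - 3, by omega⟩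
  have H' := H.reflect hg
  have hnot : ¬(p.coeff N = 0 ∧ q.coeff M = 0) := by
    rintro ⟨h1, h3⟩
    rcases le_total p.natDegree (q.natDegree + 3) with hle | hle
    · rw [max_eq_right hle] at hN
      rw [show M = q.natDegree by omega] at h3
      exact hq (leadingCoeff_eq_zero.1 h3)
    · rw [max_eq_left hle] at hN
      rw [hN] at h1
      have hp := leadingCoeff_eq_zero.1 h1
      rw [hp, natDegree_zero] at hle
      omega
  -- The leading terms cannot cancel at both places `±e`, so at one of them the pole has order
  -- exactly `N`, which is at least three when `q ≠ 0`.
  obtain ⟨μ, hμ0, hμ, hne⟩ : ∃ μ : L, μ ≠ 0 ∧ μ ^ 2 = (g.reflect 6).eval 0 ∧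
      (p.reflect N).eval 0 + (q.reflect M).eval 0 * μ ≠ 0 := by
    simp only [eval_zero_reflect]
    by_cases h1 : p.coeff N + q.coeff M * e = 0
    · refine ⟨-e, neg_ne_zero.2 he0, by rw [neg_sq, he], fun h3 => hnot ?_⟩
      have h4 : 2 * p.coeff N = 0 := by linear_combination h1 + h3
      have h5 := (mul_eq_zero.1 h4).resolve_left h2
      rw [h5, zero_add] at h1
      exact ⟨h5, (mul_eq_zero.1 h1).resolve_right he0⟩
    · exact ⟨e, he0, he, h1⟩
  obtain ⟨P, hP⟩ := H'.exists_centered hμ0 hμ h2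
  have hPt : 1 < P.v t := by
    have := hP.1
    rw [map_zero, sub_zero, map_inv₀] at this
    exact (inv_lt_one₀ (zero_lt_iff.2 ((Valuation.ne_zero_iff _).2 ht))).1 this
  have hv : P.v (aeval t⁻¹ (p.reflect N) + aeval t⁻¹ (q.reflect M) * (η * t⁻¹ ^ 3)) = 1 :=
    hP.v_eq_one ⟨_, _, rfl, hne⟩
  have e1 := aeval_inv_reflect_mul_pow ht (N := N) (p := p) (le_max_left _ _)
  have e2 := aeval_inv_reflect_mul_pow ht (N := M) (p := q) (by omega)
  have e3 : aeval t p + aeval t q * η =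
      (aeval t⁻¹ (p.reflect N) + aeval t⁻¹ (q.reflect M) * (η * t⁻¹ ^ 3)) * t ^ N := by
    have h4 : t⁻¹ ^ 3 * t ^ 3 = 1 := by rw [← mul_pow, inv_mul_cancel₀ ht, one_pow]
    rw [← e1, ← e2, hM, pow_add]
    linear_combination (-aeval t⁻¹ (q.reflect M) * η * t ^ M) * h4
  have h5 := h P hPt
  rw [e3, map_mul, hv, one_mul, map_pow] at h5
  have := (pow_le_pow_iff_right₀ hPt).1 h5
  omega

end IsQuadraticModel

namespace SexticCurve

variable {L : Type*} [Field L] (C : SexticCurve L)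

/-- A function with divisor `D` would be a polynomial in `x` by the bounds on its poles, and such a
function has equal orders at two conjugate points and at any two places at infinity. -/
theorem not_mem_principalDivisors {e : L} (he : e ^ 2 = C.g.coeff 6) (he0 : e ≠ 0)
    {D : Divisor L C.FunctionField} (hD : ∀ P : Place L C.FunctionField, P.v C.x ≤ 1 → 0 ≤ D P)
    (hD' : ∀ P : Place L C.FunctionField, 1 < P.v C.x → -2 ≤ D P)
    {P Q : Place L C.FunctionField} (hPQ : D P ≠ D Q)
    (h : (∃ a b : L, b ≠ 0 ∧ P.Centered C.x C.y a b ∧ Q.Centered C.x C.y a (-b)) ∨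
      (1 < P.v C.x ∧ 1 < Q.v C.x)) : D ∉ principalDivisors L C.FunctionField := by
  rintro ⟨z, hz0, hz⟩
  have H := C.isQuadraticModel
  have hg := C.natDegree_g.le
  have hlog : ∀ R : Place L C.FunctionField, ∀ n : ℤ, -n ≤ D R → R.v z ≤ WithZero.exp n := by
    intro R n hn
    rw [← WithZero.log_le_iff_le_exp ((Valuation.ne_zero_iff _).2 hz0)]
    rw [hz, Place.ord_eq_neg_log] at hn
    omega
  obtain ⟨p, q, hpq⟩ := C.exists_eq_of_forall_v_le_one fun R hR =>
    (hlog R 0 (by simpa using hD R hR)).trans_eq WithZero.exp_zero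
  have hq : q = 0 := by
    refine H.eq_zero_of_v_le_sq hg C.two_ne he he0 (p := p) fun R hR => ?_
    rw [← hpq, H.v_infinity hg C.two_ne he he0 hR, ← WithZero.exp_nsmul]
    exact hlog R 2 (hD' R hR)
  rw [hq, map_zero, zero_mul, add_zero] at hpq
  have hp : p ≠ 0 := by
    rintro rfl
    exact hz0 (by simpa using hpq)
  refine hPQ ?_
  rw [hz, hz, Place.ord_eq_neg_log, Place.ord_eq_neg_log, hpq]
  rcases h with ⟨a, b, hb, h1, h3⟩ | ⟨h1, h3⟩
  · rw [H.v_aeval_eq_of_centered_neg C.two_ne hb h1 h3]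
  · rw [Place.v_aeval_of_one_lt h1 hp, Place.v_aeval_of_one_lt h3 hp,
      H.v_infinity hg C.two_ne he he0 h1, H.v_infinity hg C.two_ne he he0 h3]

/-! ### Divisors given by pairs of polynomials -/

/-- `u` splits and cuts out points `(a, c(a))` of the curve `y ^ 2 = g(x)`, `c(a) ≠ 0`, completed
at infinity by the point where `y / x ^ 3` is the leading coefficient of `c`. -/
structure IsMumfordPair (g u c : L[X]) : Prop where
  natDegree_le : u.natDegree ≤ 2
  splits : u.Splits
  eval_sq : ∀ a ∈ u.roots, c.eval a ^ 2 = g.eval a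
  eval_ne : ∀ a ∈ u.roots, c.eval a ≠ 0
  infinity : u.natDegree = 2 ∨ c.coeff 3 ^ 2 = g.coeff 6

/-- The divisor of degree zero of a pair of polynomials; `e` is a square root of the leading
coefficient of `g`. -/
noncomputable def mumfordDiv (e : L) (u c : L[X]) : Divisor L C.FunctionField :=
  affDiv C.x C.y u.roots c + (2 - u.natDegree) • infPt C.x C.y (c.coeff 3) -
    (infPt C.x C.y e + infPt C.x C.y (-e))

lemma _root_.IsQuadraticModel.degree_infPt {F : Type*} [Field F] [Algebra L F] {t η : F} {g : L[X]}
    (H : IsQuadraticModel t η g) (hg : g.natDegree ≤ 6) (h2 : (2 : L) ≠ 0) {μ : L} (hμ0 : μ ≠ 0)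
    (hμ : μ ^ 2 = g.coeff 6) : Divisor.degree L F (infPt t η μ) = 1 :=
  (H.reflect hg).degree_ptDiv h2 hμ0 (by rw [IsQuadraticModel.eval_zero_reflect, hμ])

lemma degree_mumfordDiv {e : L} (he : e ^ 2 = C.g.coeff 6) (he0 : e ≠ 0) {u c : L[X]}
    (h : IsMumfordPair C.g u c) : Divisor.degree L C.FunctionField (C.mumfordDiv e u c) = 0 := by
  have H := C.isQuadraticModel
  have hg := C.natDegree_g.le
  have h1 : Divisor.degree L C.FunctionField (affDiv C.x C.y u.roots c) = u.natDegree := by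
    rw [affDiv, map_multiset_sum, Multiset.map_map, Multiset.map_congr rfl (g := fun _ => 1),
      h.splits.natDegree_eq_card_roots]
    · simp
    · intro a ha
      exact H.degree_ptDiv C.two_ne (h.eval_ne a ha) (h.eval_sq a ha)
  have h3 : Divisor.degree L C.FunctionField ((2 - u.natDegree) • infPt C.x C.y (c.coeff 3)) =
      (2 - u.natDegree : ℕ) := by
    rcases h.infinity with hd | hμ
    · simp [hd]
    · rw [map_nsmul, H.degree_infPt hg C.two_ne ?_ hμ]
      · simp
      · intro h0
        rw [h0] at hμ
        exact he0 (by rw [← hμ] at he; simpa using he)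
  have hle := h.natDegree_le
  rw [mumfordDiv, map_sub, map_add, map_add, h1, h3, H.degree_infPt hg C.two_ne he0 he,
    H.degree_infPt hg C.two_ne (neg_ne_zero.2 he0) (by rw [neg_sq, he])]
  omega

lemma affDiv_apply_of_centered {S : Multiset L} {c : L[X]} (hS : ∀ a ∈ S, c.eval a ≠ 0)
    {P : Place L C.FunctionField} {a b : L} (hP : P.Centered C.x C.y a b) [DecidableEq L] :
    affDiv C.x C.y S c P = if c.eval a = b then (S.count a : ℤ) else 0 := by
  classical
  have H := C.isQuadraticModel
  induction S using Multiset.induction_on with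
  | empty => simp [affDiv]
  | cons a' S ih =>
    have h1 := ih fun a ha => hS a (Multiset.mem_cons_of_mem ha)
    rw [affDiv] at h1 ⊢
    rw [Multiset.map_cons, Multiset.sum_cons, Finsupp.add_apply, h1,
      H.ptDiv_apply C.two_ne (hS a' (Multiset.mem_cons_self _ _)), Multiset.count_cons]
    by_cases haa : a = a'
    · subst haa
      by_cases hc : c.eval a = b
      · rw [if_pos hc, if_pos hc, if_pos (hc ▸ hP)]
        push_cast
        simp [add_comm]
      · rw [if_neg hc, if_neg hc, if_neg fun h => hc (h.eq_right hP), add_zero]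
    · rw [if_neg fun h : P.Centered C.x C.y a' (c.eval a') => haa (P.eq_of_v_sub_lt_one hP.1 h.1)]
      simp [haa]

lemma affDiv_nonneg {S : Multiset L} {c : L[X]} (hS : ∀ a ∈ S, c.eval a ≠ 0)
    (P : Place L C.FunctionField) : 0 ≤ affDiv C.x C.y S c P := by
  classical
  have H := C.isQuadraticModel
  induction S using Multiset.induction_on with
  | empty => simp [affDiv]
  | cons a' S ih =>
    have h1 := ih fun a ha => hS a (Multiset.mem_cons_of_mem ha)
    rw [affDiv] at h1 ⊢
    rw [Multiset.map_cons, Multiset.sum_cons, Finsupp.add_apply,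
      H.ptDiv_apply C.two_ne (hS a' (Multiset.mem_cons_self _ _))]
    split_ifs <;> omega

lemma mumfordDiv_apply_of_v_le_one {e : L} {u c : L[X]} {P : Place L C.FunctionField}
    (hP : P.v C.x ≤ 1) : C.mumfordDiv e u c P = affDiv C.x C.y u.roots c P := by
  have H := C.isQuadraticModel
  simp [mumfordDiv, H.infPt_apply_of_v_le_one hP]

lemma mumfordDiv_apply_of_one_lt {e : L} (he : e ^ 2 = C.g.coeff 6) (he0 : e ≠ 0) {u c : L[X]}
    {P : Place L C.FunctionField} (hP : 1 < P.v C.x) :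
    C.mumfordDiv e u c P = (2 - u.natDegree : ℕ) * infPt C.x C.y (c.coeff 3) P - 1 := by
  have H := C.isQuadraticModel
  have := H.infPt_add_infPt_neg_apply C.natDegree_g.le C.two_ne he he0 hP
  rw [mumfordDiv, Finsupp.sub_apply, this, Finsupp.add_apply,
    IsQuadraticModel.affDiv_apply_of_one_lt hP, Finsupp.smul_apply]
  simp

lemma infPt_nonneg (μ : L) (P : Place L C.FunctionField) : 0 ≤ infPt C.x C.y μ P := by
  classical
  rw [infPt, ptDiv]
  split_ifs
  · rw [Finsupp.single_apply]; split_ifs <;> simp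
  · simp

/-- The divisor has different coefficients at a point of the pair and at its conjugate. The
restriction `n ≤ 2` keeps the poles at infinity below the pole of `y`. -/
theorem nsmul_mumfordDiv_not_mem {e : L} (he : e ^ 2 = C.g.coeff 6) (he0 : e ≠ 0) {u c : L[X]}
    (h : IsMumfordPair C.g u c) {n : ℕ} (hn : n = 1 ∨ n = 2) :
    n • C.mumfordDiv e u c ∉ principalDivisors L C.FunctionField := by
  classical
  have H := C.isQuadraticModel
  have hg := C.natDegree_g.le
  have hD : ∀ P : Place L C.FunctionField, P.v C.x ≤ 1 → 0 ≤ (n • C.mumfordDiv e u c) P := by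
    intro P hP
    rw [Finsupp.smul_apply, C.mumfordDiv_apply_of_v_le_one hP]
    exact nsmul_nonneg (C.affDiv_nonneg h.eval_ne P) n
  have hD' : ∀ P : Place L C.FunctionField, 1 < P.v C.x → -2 ≤ (n • C.mumfordDiv e u c) P := by
    intro P hP
    rw [Finsupp.smul_apply, C.mumfordDiv_apply_of_one_lt he he0 hP]
    have := mul_nonneg (Nat.cast_nonneg (α := ℤ) (2 - u.natDegree))
      (C.infPt_nonneg (c.coeff 3) P)
    rcases hn with rfl | rfl
    · rw [one_smul]; omega
    · rw [two_smul]; omega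
  have hn0 : (n : ℤ) ≠ 0 := by rcases hn with rfl | rfl <;> norm_num
  by_cases hr : u.roots = 0
  -- Without affine points the pair is twice one place at infinity, and the coefficients at the two
  -- places are `n` and `-n`.
  · have hd : u.natDegree = 0 := by rw [h.splits.natDegree_eq_card_roots, hr, Multiset.card_zero]
    have hμ := h.infinity.resolve_left (by omega)
    set μ := c.coeff 3 with hμdef
    have hμ0 : μ ≠ 0 := by
      intro h0
      rw [h0] at hμ
      exact he0 (by rw [← hμ] at he; simpa using he)
    have H' := H.reflect hg
    have hinf : ∀ (ν : L) (P : Place L C.FunctionField),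
        P.Centered C.x⁻¹ (C.y * C.x⁻¹ ^ 3) 0 ν → 1 < P.v C.x := by
      intro ν P hP
      have := hP.1
      rw [map_zero, sub_zero, map_inv₀] at this
      exact (inv_lt_one₀ (zero_lt_iff.2 ((Valuation.ne_zero_iff _).2
        (by simpa using H.sub_ne_zero 0)))).1 this
    obtain ⟨P, hP⟩ := H'.exists_centered hμ0
      (by rw [IsQuadraticModel.eval_zero_reflect, hμ]) C.two_ne
    obtain ⟨Q, hQ⟩ := H'.exists_centered (neg_ne_zero.2 hμ0)
      (by rw [IsQuadraticModel.eval_zero_reflect, neg_sq, hμ]) C.two_ne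
    refine C.not_mem_principalDivisors he he0 hD hD' (P := P) (Q := Q) ?_
      (Or.inr ⟨hinf _ _ hP, hinf _ _ hQ⟩)
    have hPQ : ¬Q.Centered C.x⁻¹ (C.y * C.x⁻¹ ^ 3) 0 μ := by
      intro h'
      have : 2 * μ = 0 := by linear_combination h'.eq_right hQ
      exact hμ0 ((mul_eq_zero.1 this).resolve_left C.two_ne)
    rw [Finsupp.smul_apply, Finsupp.smul_apply, C.mumfordDiv_apply_of_one_lt he he0 (hinf _ _ hP),
      C.mumfordDiv_apply_of_one_lt he he0 (hinf _ _ hQ), ← hμdef, infPt,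
      H'.ptDiv_apply C.two_ne hμ0, H'.ptDiv_apply C.two_ne hμ0, if_pos hP, if_neg hPQ, hd]
    rcases hn with rfl | rfl <;> norm_num
  · obtain ⟨a, ha⟩ := Multiset.exists_mem_of_ne_zero hr
    have hb := h.eval_ne a ha
    obtain ⟨P, hP⟩ := H.exists_centered hb (h.eval_sq a ha) C.two_ne
    obtain ⟨Q, hQ⟩ := H.exists_centered (neg_ne_zero.2 hb)
      (by rw [neg_sq, h.eval_sq a ha]) C.two_ne
    refine C.not_mem_principalDivisors he he0 hD hD' (P := P) (Q := Q) ?_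
      (Or.inl ⟨a, _, hb, hP, hQ⟩)
    have hne : c.eval a ≠ -c.eval a := by
      intro h'
      have : 2 * c.eval a = 0 := by linear_combination h'
      exact hb ((mul_eq_zero.1 this).resolve_left C.two_ne)
    rw [Finsupp.smul_apply, Finsupp.smul_apply,
      C.mumfordDiv_apply_of_v_le_one (P.v_le_one_of_v_sub_lt_one hP.1),
      C.mumfordDiv_apply_of_v_le_one (Q.v_le_one_of_v_sub_lt_one hQ.1),
      C.affDiv_apply_of_centered h.eval_ne hP, C.affDiv_apply_of_centered h.eval_ne hQ,
      if_pos rfl, if_neg hne, smul_zero, nsmul_eq_mul]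
    have := Multiset.count_pos.2 ha
    exact mul_ne_zero hn0 (by omega)

/-! ### Relations between divisor classes -/

/-- If `c` also vanished at the double root `a`, then `(X - a)²` would divide `g`, which is
separable. -/
lemma eval_ne_zero_of_mem_roots {u w c : L[X]} {κ : L}
    (h : c ^ 2 - C.g = Polynomial.C κ * (u ^ 2 * w)) {a : L} (ha : u.eval a = 0) :
    c.eval a ≠ 0 := by
  intro hc
  obtain ⟨c', hc'⟩ := dvd_iff_isRoot.2 hc
  obtain ⟨u', hu'⟩ := dvd_iff_isRoot.2 ha
  have hdvd : (X - Polynomial.C a) * (X - Polynomial.C a) ∣ C.g :=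
    ⟨c' ^ 2 - Polynomial.C κ * (u' ^ 2 * w), by
      rw [← sub_eq_zero]
      rw [hc', hu'] at h
      linear_combination -h⟩
  exact not_isUnit_X_sub_C a (C.separable_g.squarefree _ hdvd)

lemma affDiv_add (S T : Multiset L) (c : L[X]) :
    affDiv C.x C.y (S + T) c = affDiv C.x C.y S c + affDiv C.x C.y T c := by
  simp [affDiv]

lemma sq_sub_g_ne_zero (c : L[X]) : c ^ 2 - C.g ≠ 0 := by
  have := C.isQuadraticModel.norm_ne_zero (p := c) (q := 1) (by simp)
  rwa [one_pow, one_mul] at this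

lemma y_sub_ne_zero (c : L[X]) : C.y - aeval C.x c ≠ 0 := by
  intro h
  have := C.isQuadraticModel.indep (-c) 1 (by
    simp only [map_neg, map_one]; linear_combination h)
  exact one_ne_zero this.2

/-- The sum is the divisor of `y - c(x)`: the degree missing from `c² - g` counts its zeros at the
place at infinity given by the cubic coefficient of `c`, and these complete the three pairs. -/
theorem add_add_mumfordDiv_mem {e : L} (he : e ^ 2 = C.g.coeff 6) (he0 : e ≠ 0)
    {u₁ u₂ u₃ c : L[X]} (hc : c.natDegree ≤ 3) {κ : L}
    (h : c ^ 2 - C.g = Polynomial.C κ * (u₁ * u₂ * u₃)) (h₁ : IsMumfordPair C.g u₁ c)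
    (h₂ : IsMumfordPair C.g u₂ c) (h₃ : IsMumfordPair C.g u₃ c) :
    C.mumfordDiv e u₁ c + C.mumfordDiv e u₂ c + C.mumfordDiv e u₃ c ∈
      principalDivisors L C.FunctionField := by
  refine ⟨C.y - aeval C.x c, C.y_sub_ne_zero c, fun P => ?_⟩
  have h0 := C.sq_sub_g_ne_zero c
  have hκ : κ ≠ 0 := by
    rintro rfl
    exact h0 (by simpa using h)
  have hu : u₁ * u₂ * u₃ ≠ 0 := by
    intro h'
    exact h0 (by rw [h, h', mul_zero])
  have hu12 := left_ne_zero_of_mul hu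
  have hroots : (c ^ 2 - C.g).roots = u₁.roots + u₂.roots + u₃.roots := by
    rw [h, roots_C_mul _ hκ, roots_mul hu, roots_mul hu12]
  have hdeg : (c ^ 2 - C.g).natDegree = u₁.natDegree + u₂.natDegree + u₃.natDegree := by
    rw [h, natDegree_C_mul hκ, natDegree_mul hu12 (right_ne_zero_of_mul hu),
      natDegree_mul (left_ne_zero_of_mul hu12) (right_ne_zero_of_mul hu12)]
  rw [← C.isQuadraticModel.ord_sub C.natDegree_g.le C.two_ne he he0 hc, hroots, hdeg,
    affDiv_add, affDiv_add]
  · have := h₁.natDegree_le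
    have := h₂.natDegree_le
    have := h₃.natDegree_le
    rw [show 6 - (u₁.natDegree + u₂.natDegree + u₃.natDegree) =
      (2 - u₁.natDegree) + (2 - u₂.natDegree) + (2 - u₃.natDegree) by omega]
    congr 1
    simp only [mumfordDiv, add_smul]
    abel
  · rw [h]
    exact (Splits.C κ).mul ((h₁.splits.mul h₂.splits).mul h₃.splits)
  · rw [hroots]
    intro a ha
    rcases Multiset.mem_add.1 ha with ha | ha
    · rcases Multiset.mem_add.1 ha with ha | ha
      · exact h₁.eval_ne a ha
      · exact h₂.eval_ne a ha
    · exact h₃.eval_ne a ha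

theorem four_nsmul_mumfordDiv_mem {e : L} (he : e ^ 2 = C.g.coeff 6) (he0 : e ≠ 0)
    {u c : L[X]} (hc : c.natDegree = 4) {κ : L}
    (h : c ^ 2 - C.g = Polynomial.C κ * u ^ 4) (hu : IsMumfordPair C.g u c)
    (hu2 : u.natDegree = 2) :
    4 • C.mumfordDiv e u c ∈ principalDivisors L C.FunctionField := by
  refine ⟨C.y - aeval C.x c, C.y_sub_ne_zero c, fun P => ?_⟩
  have h0 := C.sq_sub_g_ne_zero c
  have hκ : κ ≠ 0 := by
    rintro rfl
    exact h0 (by simpa using h)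
  have hroots : (c ^ 2 - C.g).roots = 4 • u.roots := by
    rw [h, roots_C_mul _ hκ, roots_pow]
  rw [← C.isQuadraticModel.ord_sub_of_natDegree_eq_four C.natDegree_g.le C.two_ne he he0 hc,
    hroots]
  · congr 1
    simp only [mumfordDiv, hu2, affDiv, Multiset.map_nsmul, Multiset.sum_nsmul]
    simp
    abel
  · rw [h]
    exact (Splits.C κ).mul (hu.splits.pow 4)
  · rw [hroots]
    intro a ha
    exact hu.eval_ne a (Multiset.mem_of_mem_nsmul ha)

/-- A pair of full degree depends only on the values of `c` at the roots of `u`, so one class can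
enter two relations through different polynomials. -/
lemma mumfordDiv_congr {e : L} {u c c' : L[X]} (hu : u.natDegree = 2)
    (h : ∀ a ∈ u.roots, c.eval a = c'.eval a) : C.mumfordDiv e u c = C.mumfordDiv e u c' := by
  rw [mumfordDiv, mumfordDiv, hu, affDiv, affDiv, Multiset.map_congr rfl fun a ha => by rw [h a ha]]
  simp

end SexticCurve

/-! ### Rational points on the Jacobian -/

section Galois

variable {k F : Type*} [Field k] [Field F] [Algebra k F] (σ : k ≃+* k) (τ : F ≃+* F)
  (h : ∀ c, τ (algebraMap k F c) = algebraMap k F (σ c))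

lemma Place.centered_map_iff {t η : F} (ht : τ t = t) (hη : τ η = η) (P : Place k F) (a b : k) :
    (Place.map σ τ h P).Centered t η (σ a) (σ b) ↔ P.Centered t η a b := by
  have key : ∀ (z : F) (c : k), τ z = z →
      (Place.map σ τ h P).v (z - algebraMap k F (σ c)) = P.v (z - algebraMap k F c) := by
    intro z c hz
    change P.v (τ.symm (z - algebraMap k F (σ c))) = _
    rw [← h, ← hz, ← map_sub, RingEquiv.symm_apply_apply, hz]
  rw [Place.Centered, Place.Centered, key t a ht, key η b hη]

lemma IsQuadraticModel.mapDomain_ptDiv {t η : F} {g : k[X]} (H : IsQuadraticModel t η g)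
    (h2 : (2 : k) ≠ 0) (ht : τ t = t) (hη : τ η = η) {a b : k} (hb : b ≠ 0) :
    Finsupp.mapDomain (Place.map σ τ h) (ptDiv t η a b) = ptDiv t η (σ a) (σ b) := by
  classical
  ext P
  obtain ⟨Q, rfl⟩ := Place.map_surjective σ τ h P
  rw [Finsupp.mapDomain_apply (Place.map_injective σ τ h), H.ptDiv_apply h2 hb,
    H.ptDiv_apply h2 (by simpa using hb), Place.centered_map_iff σ τ h ht hη]

end Galois

/-- With `2` invertible the discriminant has a square root in a separably closed field, so the
quadratic formula applies even when `u` has a double root. -/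
lemma Polynomial.splits_of_natDegree_le_two {L : Type*} [Field L] [IsSepClosed L]
    (h2 : (2 : L) ≠ 0) {u : L[X]} (hu : u.natDegree ≤ 2) : u.Splits := by
  rcases Nat.lt_or_eq_of_le hu with h | h
  · exact Splits.of_natDegree_le_one (by omega)
  have : NeZero (2 : L) := ⟨h2⟩
  have ha : u.coeff 2 ≠ 0 := by
    rw [← h]
    exact leadingCoeff_ne_zero.2 (by rintro rfl; simp at h)
  obtain ⟨δ, hδ⟩ := IsSepClosed.exists_eq_mul_self (u.coeff 1 ^ 2 - 4 * u.coeff 2 * u.coeff 0)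
  refine Splits.of_natDegree_eq_two (x := (-u.coeff 1 + δ) / (2 * u.coeff 2)) h ?_
  rw [eval_eq_sum_range' (n := 3) (by omega)]
  simp only [Finset.sum_range_succ, Finset.sum_range_zero]
  field_simp
  linear_combination -hδ

namespace SexticCurve

variable {K : Type*} [Field K] (C : SexticCurve K)

section

variable {L : Type*} [Field L] [Algebra K L]

lemma g_baseChange : (C.baseChange L).g = C.g.map (algebraMap K L) := by
  simp [g, baseChange]

lemma galoisAut_x (σ : L ≃ₐ[K] L) : C.galoisAut σ (C.baseChange L).x = (C.baseChange L).x := by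
  rw [x, galoisAut, IsFractionRing.ringEquivOfRingEquiv_algebraMap]
  congr 1
  simp [galoisEquiv, galoisHom]

lemma galoisAut_y (σ : L ≃ₐ[K] L) : C.galoisAut σ (C.baseChange L).y = (C.baseChange L).y := by
  rw [y, galoisAut, IsFractionRing.ringEquivOfRingEquiv_algebraMap]
  congr 1
  simp [galoisEquiv, galoisHom]

lemma isMumfordPair_map [IsSepClosed L] {u c k : K[X]} (hu : u.natDegree ≤ 2)
    (h : c ^ 2 - C.g = u * k) (h0 : ∀ a : L, (u.map (algebraMap K L)).eval a = 0 →
      (c.map (algebraMap K L)).eval a ≠ 0)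
    (hinf : u.natDegree = 2 ∨ c.coeff 3 ^ 2 = C.g.coeff 6) :
    IsMumfordPair (C.baseChange L).g (u.map (algebraMap K L)) (c.map (algebraMap K L)) where
  natDegree_le := by rwa [natDegree_map]
  splits := splits_of_natDegree_le_two (C.baseChange L).two_ne (by rwa [natDegree_map])
  eval_sq := fun a ha => by
    have h1 := congrArg (fun p => (p.map (algebraMap K L)).eval a) h
    simp only [Polynomial.map_sub, Polynomial.map_pow, Polynomial.map_mul, eval_sub, eval_pow,
      eval_mul, (isRoot_of_mem_roots ha).eq_zero, zero_mul] at h1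
    rw [g_baseChange]
    exact sub_eq_zero.1 h1
  eval_ne := fun a ha => h0 a (isRoot_of_mem_roots ha).eq_zero
  infinity := by
    rw [natDegree_map, coeff_map, g_baseChange, coeff_map, ← map_pow]
    exact hinf.imp_right fun h => by rw [h]

/-- The divisor of a pair of polynomials over the base field is invariant. -/
lemma mapDomain_mumfordDiv (σ : L ≃ₐ[K] L) {e : L}
    (he : e ^ 2 = (C.baseChange L).g.coeff 6) (he0 : e ≠ 0) {u c : K[X]}
    (h : IsMumfordPair (C.baseChange L).g (u.map (algebraMap K L)) (c.map (algebraMap K L))) :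
    Finsupp.mapDomain (Place.map (σ : L ≃+* L) (C.galoisAut σ) (C.galoisAut_algebraMap σ))
      ((C.baseChange L).mumfordDiv e (u.map (algebraMap K L)) (c.map (algebraMap K L))) =
    (C.baseChange L).mumfordDiv e (u.map (algebraMap K L)) (c.map (algebraMap K L)) := by
  set C' := C.baseChange L
  set u' := u.map (algebraMap K L)
  set c' := c.map (algebraMap K L)
  have H := C'.isQuadraticModel
  have H' := H.reflect C'.natDegree_g.le
  have hx : C.galoisAut σ C'.x = C'.x := C.galoisAut_x σ
  have hy : C.galoisAut σ C'.y = C'.y := C.galoisAut_y σ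
  have hcomp : (σ : L →+* L).comp (algebraMap K L) = algebraMap K L :=
    RingHom.ext fun a => by simp
  have hc' : c'.map (σ : L →+* L) = c' := by rw [Polynomial.map_map, hcomp]
  have hu' : u'.map (σ : L →+* L) = u' := by rw [Polynomial.map_map, hcomp]
  -- As `u` and `c` have coefficients in `K`, `σ` permutes the roots of `u` and carries `(a, c(a))`
  -- to `(σ a, c(σ a))`.
  have hroots : u'.roots.map (σ : L →+* L) = u'.roots := by
    rw [← h.splits.roots_map, hu']
  set Φ := Finsupp.mapDomain.addMonoidHom (M := ℤ)
    (Place.map (σ : L ≃+* L) (C.galoisAut σ) (C.galoisAut_algebraMap σ)) with hΦ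
  change Φ _ = _
  have haff : Φ (affDiv C'.x C'.y u'.roots c') = affDiv C'.x C'.y u'.roots c' := by
    have h1 : affDiv C'.x C'.y u'.roots c' =
        ((u'.roots.map (σ : L →+* L)).map fun a => ptDiv C'.x C'.y a (c'.eval a)).sum := by
      rw [hroots, affDiv]
    conv_rhs => rw [h1]
    rw [affDiv, map_multiset_sum, Multiset.map_map, Multiset.map_map]
    refine congrArg _ (Multiset.map_congr rfl fun a ha => ?_)
    refine (H.mapDomain_ptDiv _ _ _ C'.two_ne hx hy (h.eval_ne a ha)).trans ?_
    have : c'.eval (σ a) = σ (c'.eval a) := by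
      have := eval_map_apply (σ : L →+* L) a (p := c')
      rw [hc'] at this
      exact this
    simp only [Function.comp_apply, RingHom.coe_coe, this]
    rfl
  have hinf : ∀ μ : L, μ ≠ 0 → Φ (infPt C'.x C'.y μ) = infPt C'.x C'.y (σ μ) := by
    intro μ hμ
    refine (H'.mapDomain_ptDiv _ _ _ C'.two_ne ?_ ?_ hμ).trans ?_
    · rw [map_inv₀, hx]
    · rw [map_mul, map_pow, map_inv₀, hx, hy]
    · rw [map_zero]; rfl
  have hinf' : Φ ((2 - u'.natDegree) • infPt C'.x C'.y (c'.coeff 3)) =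
      (2 - u'.natDegree) • infPt C'.x C'.y (c'.coeff 3) := by
    rcases h.infinity with hd | hμ
    · simp [hd]
    · rw [map_nsmul, hinf, coeff_map, AlgEquiv.commutes]
      intro h0
      rw [h0] at hμ
      exact he0 (by rw [← hμ] at he; simpa using he)
  -- The root `e` need not lie in `K`: `σ` may exchange the two places at infinity, but it fixes
  -- their sum.
  have hK : Φ (infPt C'.x C'.y e + infPt C'.x C'.y (-e)) =
      infPt C'.x C'.y e + infPt C'.x C'.y (-e) := by
    rw [map_add, hinf e he0, hinf (-e) (neg_ne_zero.2 he0), map_neg]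
    have hσ : σ e ^ 2 = e ^ 2 := by
      rw [← map_pow, he, g_baseChange, coeff_map, AlgEquiv.commutes]
    rcases sq_eq_sq_iff_eq_or_eq_neg.1 hσ with h1 | h1
    · rw [h1]
    · rw [h1, neg_neg, add_comm]
  rw [mumfordDiv, map_sub, map_add, haff, hinf', hK]

end

/-- A point of the Jacobian of order `48` from a point of order `16`, which is half of
half of a point of order `4`, and a point of order `3`. -/
theorem exists_addOrderOf_eq_forty_eight {u c p ℓ n q w r : K[X]} {y₁ y₂ κ₁ κ₂ κ₃ κ₄ : K}
    (hu : u.natDegree ≤ 2) (hc : c.natDegree ≤ 3)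
    (h₁ : c ^ 2 - C.g = Polynomial.C κ₁ * (u ^ 2 * p))
    (huinf : u.natDegree = 2 ∨ c.coeff 3 ^ 2 = C.g.coeff 6)
    (hp : p.natDegree = 2) (hpc : p ∣ c - Polynomial.C y₁) (hy₁ : y₁ ≠ 0)
    (hℓ : ℓ.natDegree ≤ 3) (h₂ : ℓ ^ 2 - C.g = Polynomial.C κ₂ * (p ^ 2 * n))
    (hpℓ : p ∣ ℓ - Polynomial.C y₁) (hn : n.natDegree = 2) (hnℓ : n ∣ ℓ - Polynomial.C y₂)
    (hy₂ : y₂ ≠ 0) (hq : q.natDegree = 4) (h₃ : q ^ 2 - C.g = Polynomial.C κ₃ * n ^ 4)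
    (hnq : n ∣ q - Polynomial.C y₂)
    (hw : w.natDegree ≤ 2) (hr : r.natDegree ≤ 3) (h₄ : r ^ 2 - C.g = Polynomial.C κ₄ * w ^ 3)
    (hwinf : w.natDegree = 2 ∨ r.coeff 3 ^ 2 = C.g.coeff 6) :
    ∃ P : C.jacobianPoints, addOrderOf P = 48 := by
  let L := SeparableClosure K
  let C' := C.baseChange L
  have h2 : (2 : L) ≠ 0 := C'.two_ne
  have : NeZero (2 : L) := ⟨h2⟩
  obtain ⟨e, he'⟩ := IsSepClosed.exists_eq_mul_self (C'.g.coeff 6)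
  have he : e ^ 2 = C'.g.coeff 6 := by rw [he', pow_two]
  have he0 : e ≠ 0 := by
    rintro rfl
    have h6 : C'.g.coeff C'.g.natDegree ≠ 0 :=
      leadingCoeff_ne_zero.2 (C'.separable_g.ne_zero)
    rw [C'.natDegree_g, he', zero_mul] at h6
    exact h6 rfl
  let φ : K[X] → L[X] := fun f => f.map (algebraMap K L)
  have hφg : C'.g = φ C.g := C.g_baseChange
  -- values at the roots
  have hval : ∀ {s f : K[X]} {b : K}, s ∣ f - Polynomial.C b → ∀ a : L, (φ s).eval a = 0 →
      (φ f).eval a = algebraMap K L b := by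
    rintro s f b ⟨k, hk⟩ a ha
    have h1 := congrArg (fun f => (φ f).eval a) hk
    simp only [φ, Polynomial.map_sub, Polynomial.map_mul, eval_sub, eval_mul, map_C, eval_C]
      at h1 ha
    rw [ha, zero_mul, sub_eq_zero] at h1
    exact h1
  have hval0 : ∀ {s f : K[X]} {b : K}, b ≠ 0 → s ∣ f - Polynomial.C b → ∀ a : L,
      (φ s).eval a = 0 → (φ f).eval a ≠ 0 := by
    intro s f b hb hs a ha
    rw [hval hs a ha]
    simpa using hb
  have hdouble : ∀ {f s t : K[X]} {κ : K}, f ^ 2 - C.g = Polynomial.C κ * (s ^ 2 * t) →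
      ∀ a : L, (φ s).eval a = 0 → (φ f).eval a ≠ 0 := by
    intro f s t κ h a ha
    refine C'.eval_ne_zero_of_mem_roots (u := φ s) (w := φ t) (κ := algebraMap K L κ) ?_ ha
    have := congrArg φ h
    simpa [φ, hφg] using this
  have hmap3 : ∀ {f s₁ s₂ s₃ : K[X]} {κ : K}, f ^ 2 - C.g = Polynomial.C κ * (s₁ * s₂ * s₃) →
      φ f ^ 2 - C'.g = Polynomial.C (algebraMap K L κ) * (φ s₁ * φ s₂ * φ s₃) := by
    intro f s₁ s₂ s₃ κ h
    have := congrArg φ h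
    simpa [φ, hφg] using this
  have hdegφ : ∀ f : K[X], (φ f).natDegree = f.natDegree := fun f => natDegree_map _
  -- the pairs of polynomials
  have mu : IsMumfordPair C'.g (φ u) (φ c) :=
    C.isMumfordPair_map (k := Polynomial.C κ₁ * (u * p)) hu (by rw [h₁]; ring) (hdouble h₁) huinf
  have mp : IsMumfordPair C'.g (φ p) (φ c) :=
    C.isMumfordPair_map (k := Polynomial.C κ₁ * u ^ 2) hp.le (by rw [h₁]; ring) (hval0 hy₁ hpc)
      (Or.inl hp)
  have mp' : IsMumfordPair C'.g (φ p) (φ ℓ) :=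
    C.isMumfordPair_map (k := Polynomial.C κ₂ * (p * n)) hp.le (by rw [h₂]; ring) (hval0 hy₁ hpℓ)
      (Or.inl hp)
  have mn : IsMumfordPair C'.g (φ n) (φ ℓ) :=
    C.isMumfordPair_map (k := Polynomial.C κ₂ * p ^ 2) hn.le (by rw [h₂]; ring) (hval0 hy₂ hnℓ)
      (Or.inl hn)
  have mn' : IsMumfordPair C'.g (φ n) (φ q) :=
    C.isMumfordPair_map (k := Polynomial.C κ₃ * n ^ 3) hn.le (by rw [h₃]; ring) (hval0 hy₂ hnq)
      (Or.inl hn)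
  have mw : IsMumfordPair C'.g (φ w) (φ r) :=
    C.isMumfordPair_map (k := Polynomial.C κ₄ * w ^ 2) hw (by rw [h₄]; ring)
      (hdouble (t := w) (κ := κ₄) (by rw [h₄]; ring)) hwinf
  -- the divisor classes
  let mk := QuotientAddGroup.mk' (principalDivisors L C'.FunctionField)
  have hmk : ∀ D, mk D = 0 ↔ D ∈ principalDivisors L C'.FunctionField :=
    fun D => QuotientAddGroup.eq_zero_iff D
  let A := mk (C'.mumfordDiv e (φ u) (φ c))
  let T := mk (C'.mumfordDiv e (φ w) (φ r))
  let P := mk (C'.mumfordDiv e (φ p) (φ c))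
  let N := mk (C'.mumfordDiv e (φ n) (φ ℓ))
  -- Both `c` and `ℓ` take the constant value `y₁` on the roots of `p`, so the two relations speak
  -- of the same class.
  have eP : P = mk (C'.mumfordDiv e (φ p) (φ ℓ)) := by
    change mk _ = mk _
    rw [C'.mumfordDiv_congr ((hdegφ p).trans hp)]
    intro a ha
    have ha' := (isRoot_of_mem_roots ha).eq_zero
    rw [hval hpc a ha', hval hpℓ a ha']
  have eN : N = mk (C'.mumfordDiv e (φ n) (φ q)) := by
    change mk _ = mk _
    rw [C'.mumfordDiv_congr ((hdegφ n).trans hn)]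
    intro a ha
    have ha' := (isRoot_of_mem_roots ha).eq_zero
    rw [hval hnℓ a ha', hval hnq a ha']
  have rel₁ : 2 • A + P = 0 := by
    have := (hmk _).2 (C'.add_add_mumfordDiv_mem he he0 ((hdegφ c).trans_le hc)
      (hmap3 (s₁ := u) (s₂ := u) (s₃ := p) (by rw [h₁]; ring)) mu mu mp)
    rw [map_add, map_add] at this
    rw [two_nsmul]
    exact this
  have rel₂ : 2 • P + N = 0 := by
    have := (hmk _).2 (C'.add_add_mumfordDiv_mem he he0 ((hdegφ ℓ).trans_le hℓ)
      (hmap3 (s₁ := p) (s₂ := p) (s₃ := n) (by rw [h₂]; ring)) mp' mp' mn)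
    rw [map_add, map_add] at this
    rw [two_nsmul, eP]
    exact this
  have rel₃ : 4 • N = 0 := by
    have := (hmk _).2 (C'.four_nsmul_mumfordDiv_mem he he0 ((hdegφ q).trans hq)
      (κ := algebraMap K L κ₃) (by simpa [φ, hφg] using congrArg φ h₃) mn' ((hdegφ n).trans hn))
    rw [map_nsmul] at this
    rw [eN]
    exact this
  have rel₄ : 3 • T = 0 := by
    have := (hmk _).2 (C'.add_add_mumfordDiv_mem he he0 ((hdegφ r).trans_le hr)
      (hmap3 (s₁ := w) (s₂ := w) (s₃ := w) (κ := κ₄) (by rw [h₄]; ring)) mw mw mw)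
    rw [map_add, map_add] at this
    rw [succ_nsmul, two_nsmul]
    exact this
  have hN : 2 • N ≠ 0 := by
    intro h
    have h' : mk (2 • C'.mumfordDiv e (φ n) (φ ℓ)) = 0 := by rw [map_nsmul]; exact h
    exact C'.nsmul_mumfordDiv_not_mem he he0 mn (Or.inr rfl) ((hmk _).1 h')
  have hT : T ≠ 0 := by
    intro h
    have h' : mk (1 • C'.mumfordDiv e (φ w) (φ r)) = 0 := by rw [one_smul]; exact h
    exact C'.nsmul_mumfordDiv_not_mem he he0 mw (Or.inl rfl) ((hmk _).1 h')
  have hA8 : 8 • A = 2 • N := by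
    clear_value A P N
    have h : 8 • A - 2 • N = 4 • (2 • A + P) - 2 • (2 • P + N) := by abel
    rwa [rel₁, rel₂, smul_zero, smul_zero, sub_zero, sub_eq_zero] at h
  -- `8A = 2N` is nonzero and `16A = 4N` is zero.
  have oA : addOrderOf A = 2 ^ (3 + 1) := by
    refine addOrderOf_eq_prime_pow ?_ ?_
    · rw [show (2 ^ 3 : ℕ) = 8 by norm_num, hA8]
      exact hN
    · rw [show (2 ^ (3 + 1) : ℕ) = 8 * 2 by norm_num, mul_nsmul, hA8, ← mul_nsmul]
      exact rel₃
  have oT : addOrderOf T = 3 := addOrderOf_eq_prime rel₄ hT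
  have oAT : addOrderOf (A + T) = 48 := by
    rw [(AddCommute.all A T).addOrderOf_add_eq_mul_addOrderOf_of_coprime, oA, oT]
    · norm_num
    · rw [oA, oT]
      norm_num
  have hmem : ∀ {s f : K[X]}, IsMumfordPair C'.g (φ s) (φ f) →
      mk (C'.mumfordDiv e (φ s) (φ f)) ∈ C.jacobianPoints := by
    intro s f hsf
    refine ⟨⟨_, C'.degree_mumfordDiv he he0 hsf, rfl⟩, fun σ => ?_⟩
    exact congrArg mk (C.mapDomain_mumfordDiv σ he he0 hsf)
  refine ⟨⟨A + T, add_mem (hmem mu) (hmem mw)⟩, ?_⟩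
  rw [← oAT]
  exact (addOrderOf_injective C.jacobianPoints.subtype Subtype.val_injective _).symm

end SexticCurve

/-! ### Explicit relations for the family, with `s = 3t` to clear denominators -/

namespace C24

variable {K : Type*} [Field K]

lemma d_three_mul (h3 : (3 : K) ≠ 0) (t : K) :
    d (3 * t) = 81 * t ^ 4 + 378 * t ^ 2 + 1736 * t - 147 := by
  unfold d
  field_simp
  ring

lemma c₄_three_mul (h3 : (3 : K) ≠ 0) (t : K) :
    c₄ (3 * t) = -31 * (81 * t ^ 4 + 378 * t ^ 2 - 147) + 32200 * t := by
  unfold c₄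
  field_simp
  ring

lemma c₂_three_mul (t : K) :
    c₂ (3 * t) = 2 ^ 8 * (6561 * t ^ 8 + 61236 * t ^ 6 - 281232 * t ^ 5 + 119070 * t ^ 4
      - 1312416 * t ^ 3 + 481572 * t ^ 2 + 510384 * t + 21609) := by
  unfold c₂
  field_simp
  ring

lemma c₀_three_mul (h3 : (3 : K) ≠ 0) (t : K) :
    c₀ (3 * t) = 2 ^ 20 * 7 * t * (9 * t ^ 2 + 7) ^ 3 * (9 * t ^ 2 + 63) := by
  unfold c₀
  field_simp
  ring

lemma sextic_three_mul (h3 : (3 : K) ≠ 0) (t : K) :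
    sextic (3 * t) = X ^ 6 + (-31 * (81 * C t ^ 4 + 378 * C t ^ 2 - 147) + 32200 * C t) * X ^ 4
      + 2 ^ 8 * (6561 * C t ^ 8 + 61236 * C t ^ 6 - 281232 * C t ^ 5 + 119070 * C t ^ 4
      - 1312416 * C t ^ 3 + 481572 * C t ^ 2 + 510384 * C t + 21609) * X ^ 2
      + 2 ^ 20 * 7 * C t * (9 * C t ^ 2 + 7) ^ 3 * (9 * C t ^ 2 + 63) := by
  rw [sextic, c₄_three_mul h3, c₂_three_mul, c₀_three_mul h3]
  simp only [map_add, map_sub, map_mul, map_pow, map_neg, map_ofNat]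

/-- Turns an identity for `δ F² - f` with denominators cleared into the shape `F² - g = const · Z`
of a relation between classes. -/
lemma sq_sub_eq {k k' δ : K} (hk : k ≠ 0) (hδ : δ ≠ 0) {F f Z : K[X]}
    (h : C k * (C δ * F ^ 2 - f) = C k' * Z) : F ^ 2 - C δ⁻¹ * f = C (k' / (k * δ)) * Z := by
  have hkδ : C (k * δ) ≠ 0 := C_ne_zero.2 (mul_ne_zero hk hδ)
  have e1 : C δ * C δ⁻¹ = 1 := by rw [← C_mul, mul_inv_cancel₀ hδ, C_1]
  have e2 : C (k * δ) * C (k' / (k * δ)) = C k' := by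
    rw [← C_mul, mul_div_cancel₀ _ (mul_ne_zero hk hδ)]
  refine mul_left_cancel₀ hkδ ?_
  rw [← mul_assoc, e2, ← h, C_mul]
  linear_combination (-(C k * f)) * e1

/-- The cubic `-3κδ + (X² - κa)(mX + n)` meets the sextic curve in a double pair of points and in
the pair of points over `X² = κa`. -/
lemma tangent_eq {a δ b m n κ : K} {f : K[X]}
    (hf : f = (X ^ 2 - C (κ * a) + C (κ * δ))
      * (C (9 * κ * δ ^ 2) + (X ^ 2 - C (κ * a)) * (X ^ 2 + C b)))
    (hm : κ * δ * m ^ 2 = κ - n ^ 2) (hn : a * n ^ 2 + 6 * δ * n + b = 0) :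
    C κ * (C δ * (C (-(3 * κ * δ)) + (X ^ 2 - C (κ * a)) * (C m * X + C n)) ^ 2 - f)
      = C (-1) * ((C n * X ^ 2 - C (κ * δ * m) * X - C (κ * (a * n + 3 * δ))) ^ 2
        * (X ^ 2 - C (κ * a))) := by
  subst hf
  have hm' := congrArg (C : K → K[X]) hm
  have hn' := congrArg (C : K → K[X]) hn
  simp only [map_add, map_sub, map_mul, map_pow, map_neg, map_ofNat, map_one, map_zero]
    at hm' hn' ⊢
  -- The factor `X² - κa` splits off since `f = δ (3κδ)²` where `X² = κa`. The remaining quartic has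
  -- leading coefficient `δm² - 1`, which `hm` makes `-n²/κ`; with `hn` the whole quartic becomes
  -- `-1/κ` times a square.
  linear_combination (X ^ 2 * (X ^ 2 - C κ * C a) * (X ^ 2 - C κ * C a + C κ * C δ)) * hm'
    - C κ * (X ^ 2 - C κ * C a) * (X ^ 2 - C κ * C a + C κ * C δ) * hn'

/-- The source of the point of order 3: an odd cubic `y = r(x)` whose intersection with the curve is
three times a pair of points. -/
lemma cube_eq (h3 : (3 : K) ≠ 0) (t : K) :
    3 * (C (d (3 * t)) * ((93 * C t + 63) * X ^ 3
        - 16 * (9 * C t ^ 2 - 21) * (96 * C t * (9 * C t ^ 2 + 63)) * X) ^ 2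
      - (96 * C t * (9 * C t ^ 2 + 63)) ^ 2 * sextic (3 * t))
    = -(7 * (3072 * C t * (9 * C t ^ 2 + 7) * (9 * C t ^ 2 + 63)
        + (27 * C t ^ 2 - 186 * C t + 63) * X ^ 2) ^ 3) := by
  rw [sextic_three_mul h3, d_three_mul h3]
  simp only [map_add, map_sub, map_mul, map_pow, map_ofNat]
  ring

/-- The source of the point of order 4. With `V = X² - v`, where `v` is the constant subtracted from
`X²`, it says `f = (V + 16d)(V² + dV + 16d²)`, written as a difference of squares. -/
lemma quartic_eq (h3 : (3 : K) ≠ 0) (t : K) :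
    (32 * C (d (3 * t)) ^ 2 + 2 * C (d (3 * t))
        * (X ^ 2 - C (16 * (81 * t ^ 4 + 378 * t ^ 2 - 56 * t - 147)))
        + (X ^ 2 - C (16 * (81 * t ^ 4 + 378 * t ^ 2 - 56 * t - 147))) ^ 2) ^ 2
      - 4 * C (d (3 * t)) * sextic (3 * t)
    = (X ^ 2 - C (16 * (81 * t ^ 4 + 378 * t ^ 2 - 56 * t - 147))) ^ 4 := by
  rw [sextic_three_mul h3, d_three_mul h3]
  simp only [map_add, map_sub, map_mul, map_pow, map_ofNat]
  ring

/-- A point of order `48`, from a cubic that is tangent to the curve as in `tangent_eq` and a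
conic `y = -3κδ - σ(X² - κa)` that is tangent to it at the points over `X² = κa`. -/
lemma exists_addOrderOf_eq_of_tangent {t : K} (h2 : (2 : K) ≠ 0) (h3 : (3 : K) ≠ 0)
    (h7 : (7 : K) ≠ 0) (hs : c₀ (3 * t) * d (3 * t) ≠ 0) {a b m n κ σ ε : K} (hκ : κ ≠ 0)
    (hf : sextic (3 * t) = (X ^ 2 - C (κ * a) + C (κ * d (3 * t)))
      * (C (9 * κ * d (3 * t) ^ 2) + (X ^ 2 - C (κ * a)) * (X ^ 2 + C b)))
    (hm : κ * d (3 * t) * m ^ 2 = κ - n ^ 2) (hn : a * n ^ 2 + 6 * d (3 * t) * n + b = 0)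
    (hℓ : C (d (3 * t)) * (C (-(3 * κ * d (3 * t))) - C σ * (X ^ 2 - C (κ * a))) ^ 2
      - sextic (3 * t) = -((X ^ 2 - C (κ * a)) ^ 2
        * (X ^ 2 - C (16 * (81 * t ^ 4 + 378 * t ^ 2 - 56 * t - 147)))))
    (hε : ε ^ 2 = 1)
    (hσ : 3 * κ * d (3 * t) + σ * (16 * (81 * t ^ 4 + 378 * t ^ 2 - 56 * t - 147) - κ * a)
      + 16 * ε * d (3 * t) = 0) :
    ∃ P : (curve (3 * t) h2 h3 h7 hs).jacobianPoints, addOrderOf P = 48 := by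
  have hδ : d (3 * t) ≠ 0 := right_ne_zero_of_mul hs
  have hc₀ := left_ne_zero_of_mul hs
  rw [c₀_three_mul h3] at hc₀
  have ht : t ≠ 0 := by
    rintro rfl
    simp at hc₀
  have ht₁ : 9 * t ^ 2 + 7 ≠ 0 := by
    intro h
    simp [h] at hc₀
  have ht₂ : 9 * t ^ 2 + 63 ≠ 0 := by
    intro h
    simp [h] at hc₀
  have h4 : (4 : K) ≠ 0 := by
    rw [show (4 : K) = 2 ^ 2 by norm_num]
    exact pow_ne_zero _ h2
  have h16 : (16 : K) ≠ 0 := by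
    rw [show (16 : K) = 2 ^ 4 by norm_num]
    exact pow_ne_zero _ h2
  have hε₀ : ε ≠ 0 := by
    rintro rfl
    simp at hε
  have h96 : (96 : K) ≠ 0 := by
    rw [show (96 : K) = 2 ^ 5 * 3 by norm_num]
    exact mul_ne_zero (pow_ne_zero _ h2) h3
  have h3κ : 3 * κ * d (3 * t) ≠ 0 := mul_ne_zero (mul_ne_zero h3 hκ) hδ
  have htan := tangent_eq hf hm hn
  have hquart := quartic_eq h3 t
  have hcube := cube_eq h3 t
  have hdt := d_three_mul h3 t
  have hg : (curve (3 * t) h2 h3 h7 hs).g = C (d (3 * t))⁻¹ * sextic (3 * t) := rfl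
  have hg₆ : (C (d (3 * t))⁻¹ * sextic (3 * t)).coeff 6 = (d (3 * t))⁻¹ := by
    simp [sextic]
  generalize curve (3 * t) h2 h3 h7 hs = E at *
  clear hs
  generalize d (3 * t) = δ at *
  generalize sextic (3 * t) = f at *
  generalize hv : 16 * (81 * t ^ 4 + 378 * t ^ 2 - 56 * t - 147) = v at *
  set ω : K := 96 * t * (9 * t ^ 2 + 63) with hω
  have hω₀ : ω ≠ 0 := mul_ne_zero (mul_ne_zero h96 ht) ht₂
  refine E.exists_addOrderOf_eq_forty_eight
    (u := C n * X ^ 2 - C (κ * δ * m) * X - C (κ * (a * n + 3 * δ)))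
    (c := C (-(3 * κ * δ)) + (X ^ 2 - C (κ * a)) * (C m * X + C n))
    (p := X ^ 2 - C (κ * a))
    (ℓ := C (-(3 * κ * δ)) - C σ * (X ^ 2 - C (κ * a)))
    (n := X ^ 2 - C v)
    -- This is the quartic of `quartic_eq` divided by `2δ`, with a sign. Where `X² = v` it equals
    -- `16εδ`, and `hσ` says that `ℓ` takes the same value there.
    (q := C ε * (C (16 * δ) + (X ^ 2 - C v) + C (2 * δ)⁻¹ * (X ^ 2 - C v) ^ 2))
    (w := C (32 * ω * (9 * t ^ 2 + 7)) + C (27 * t ^ 2 - 186 * t + 63) * X ^ 2)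
    (r := C ((93 * t + 63) / ω) * X ^ 3 - C (16 * (9 * t ^ 2 - 21)) * X)
    (y₁ := -(3 * κ * δ)) (y₂ := 16 * ε * δ)
    ?_ ?_ (by rw [hg]; exact sq_sub_eq hκ hδ htan) ?_ natDegree_X_pow_sub_C ?_
    (neg_ne_zero.2 h3κ) ?_
    (by rw [hg]; exact sq_sub_eq (k := 1) (k' := -1) one_ne_zero hδ (by simpa using hℓ)) ?_
    natDegree_X_pow_sub_C ?_ ?_ ?_
    (by
      rw [hg]
      refine sq_sub_eq (k := 4 * δ) (k' := 1) (mul_ne_zero h4 hδ) hδ ?_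
      have hE : C (2 * δ)⁻¹ * (2 * C δ) = 1 := by
        rw [← map_ofNat C, ← C_mul, ← C_mul, inv_mul_cancel₀ (mul_ne_zero h2 hδ), C_1]
      have hε' := congrArg (C : K → K[X]) hε
      generalize C (2 * δ)⁻¹ = e at *
      simp only [map_mul, map_pow, map_ofNat, map_one] at hε' ⊢
      linear_combination hquart + (32 * C δ ^ 2 + 2 * C δ * (X ^ 2 - C v)
          + 2 * C δ * e * (X ^ 2 - C v) ^ 2) ^ 2 * hε'
        + (X ^ 2 - C v) ^ 2 * (2 * (32 * C δ ^ 2 + 2 * C δ * (X ^ 2 - C v))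
          + (e * (2 * C δ) + 1) * (X ^ 2 - C v) ^ 2) * hE) ?_ ?_ ?_ 
    (by
      rw [hg]
      refine sq_sub_eq (k := 3 * ω ^ 2) (k' := -7) (mul_ne_zero h3 (pow_ne_zero _ hω₀)) hδ ?_
      have hβ : C ω * C ((93 * t + 63) / ω) = 93 * C t + 63 := by
        rw [← C_mul, mul_div_cancel₀ _ hω₀]
        simp only [map_add, map_mul, map_ofNat]
      generalize C ((93 * t + 63) / ω) = β at *
      simp only [map_add, map_sub, map_mul, map_pow, map_neg, map_ofNat, hω] at hβ ⊢
      linear_combination hcube + 3 * C δ * X ^ 3 * (96 * C t * (9 * C t ^ 2 + 63) * β * X ^ 3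
        + (93 * C t + 63) * X ^ 3
        - 32 * (9 * C t ^ 2 - 21) * (96 * C t * (9 * C t ^ 2 + 63)) * X) * hβ) ?_
  · compute_degree
  · compute_degree
  -- If `n = 0` then `u` drops in degree; `hm` gives `m² = 1/δ`, so the missing point is the one at
  -- infinity where `y / x³ = m`.
  · by_cases hn₀ : n = 0
    · right
      have hc : C (-(3 * κ * δ)) + (X ^ 2 - C (κ * a)) * (C m * X + C n)
          = C m * X ^ 3 + C n * X ^ 2 + C (-(κ * a * m)) * X + C (-(3 * κ * δ) - κ * a * n) := by
        simp only [map_sub, map_mul, map_neg, map_ofNat]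
        ring
      rw [hg, hg₆, hc, ← mul_eq_one_iff_eq_inv₀ hδ]
      simp only [coeff_add, coeff_C_mul, coeff_X_pow, coeff_X, coeff_C]
      norm_num
      refine mul_left_cancel₀ hκ ?_
      linear_combination hm - n * hn₀
    · left
      compute_degree!
  · exact ⟨C m * X + C n, by ring⟩
  · compute_degree
    norm_num
  · exact ⟨-C σ, by ring⟩
  · refine ⟨-C σ, ?_⟩
    have := congrArg (C : K → K[X]) hσ
    simp only [map_add, map_sub, map_mul, map_neg, map_ofNat, map_zero] at this ⊢
    linear_combination -this
  · exact mul_ne_zero (mul_ne_zero h16 hε₀) hδ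
  · have h2δ : (2 * δ)⁻¹ ≠ 0 := inv_ne_zero (mul_ne_zero h2 hδ)
    compute_degree!
  · refine ⟨C ε * (1 + C (2 * δ)⁻¹ * (X ^ 2 - C v)), ?_⟩
    simp only [map_mul, map_ofNat]
    ring
  · compute_degree
  · compute_degree
  -- If `w` loses its leading term, the top coefficient of `cube_eq` shows that the leading
  -- coefficient of `r` is a square root of `1/δ`.
  · by_cases hw : 27 * t ^ 2 - 186 * t + 63 = 0
    · right
      rw [hg, hg₆, ← mul_eq_one_iff_eq_inv₀ hδ]
      simp only [coeff_sub, coeff_C_mul, coeff_X_pow, coeff_X]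
      norm_num
      rw [div_pow, div_mul_eq_mul_div, div_eq_one_iff_eq (pow_ne_zero _ hω₀)]
      refine mul_left_cancel₀ h3 ?_
      rw [hω, hdt]
      linear_combination -7 * (27 * t ^ 2 - 186 * t + 63) ^ 2 * hw
    · left
      compute_degree!

lemma exists_addOrderOf_eq_of_ne_zero {t : K} (h2 : (2 : K) ≠ 0) (h3 : (3 : K) ≠ 0)
    (h7 : (7 : K) ≠ 0) (hs : c₀ (3 * t) * d (3 * t) ≠ 0) {ρ M : K}
    (hρ : ρ ^ 2 = 2 * ((3 * t) ^ 2 + 7) * ((3 * t) ^ 2 + 63))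
    (hM : M ^ 2 = 6 * (5 * (3 * t) ^ 4 + 210 * (3 * t) ^ 2 - 392 * (3 * t) - 735)
      + 24 * ((3 * t) ^ 2 + 7) * ρ)
    (ha : 81 * t ^ 4 + 378 * t ^ 2 + 840 * t - 147 ≠ 0) :
    ∃ P : (curve (3 * t) h2 h3 h7 hs).jacobianPoints, addOrderOf P = 48 := by
  have h32 : (32 : K) ≠ 0 := by
    rw [show (32 : K) = 2 ^ 5 by norm_num]
    exact pow_ne_zero _ h2
  have hdt := d_three_mul h3 t
  set a : K := 81 * t ^ 4 + 378 * t ^ 2 + 840 * t - 147 with ha'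
  -- `b` is read off from the coefficient of `X⁴`, namely `b = c₄ + 2κa - κd`. The quadratic for `n`
  -- has quarter discriminant `9d² - ab = (2(s² + 7)ρ)²`, and `M` is the square root needed for `m`.
  refine exists_addOrderOf_eq_of_tangent h2 h3 h7 hs (a := a)
    (b := -31 * (81 * t ^ 4 + 378 * t ^ 2 - 147) + 32200 * t + 64 * a - 32 * d (3 * t))
    (n := (-3 * d (3 * t) + 2 * (9 * t ^ 2 + 7) * ρ) / a) (m := M / (8 * a))
    (κ := 32) (σ := 7) (ε := 1) h32 ?_ ?_ ?_ ?_ (one_pow 2) ?_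
  · rw [sextic_three_mul h3, hdt, ha']
    simp only [map_add, map_sub, map_mul, map_neg, map_pow, map_ofNat]
    ring
  · have h8 : (8 : K) ≠ 0 := by
      rw [show (8 : K) = 2 ^ 3 by norm_num]
      exact pow_ne_zero _ h2
    have key : d (3 * t) * M ^ 2
        = 64 * a ^ 2 - 2 * (-3 * d (3 * t) + 2 * (9 * t ^ 2 + 7) * ρ) ^ 2 := by
      rw [ha', hdt]
      linear_combination (81 * t ^ 4 + 378 * t ^ 2 + 1736 * t - 147) * hM
        + 8 * (9 * t ^ 2 + 7) ^ 2 * hρ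
    refine mul_left_cancel₀ (mul_ne_zero h2 (pow_ne_zero 2 ha)) ?_
    field_simp
    linear_combination 32 * key
  · refine mul_left_cancel₀ ha ?_
    have e : a * ((-3 * d (3 * t) + 2 * (9 * t ^ 2 + 7) * ρ) / a)
        = -3 * d (3 * t) + 2 * (9 * t ^ 2 + 7) * ρ := mul_div_cancel₀ _ ha
    generalize (-3 * d (3 * t) + 2 * (9 * t ^ 2 + 7) * ρ) / a = n at e ⊢
    have e' : a * n + 3 * d (3 * t) = 2 * (9 * t ^ 2 + 7) * ρ := by linear_combination e
    rw [hdt] at e' ⊢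
    linear_combination (a * n + 3 * (81 * t ^ 4 + 378 * t ^ 2 + 1736 * t - 147)
      + 2 * (9 * t ^ 2 + 7) * ρ) * e' + 4 * (9 * t ^ 2 + 7) ^ 2 * hρ
  · rw [sextic_three_mul h3, hdt, ha']
    simp only [map_add, map_sub, map_mul, map_neg, map_pow, map_ofNat]
    ring
  · rw [hdt, ha']
    ring

/-- The second construction, for the case in which the quadratic for `n` with `κ = 32` degenerates.
Here `ε = -1`: the conic passes through the opposite points over `X² = v`, so the class halved twice
is the negative of the former `N`. -/
lemma exists_addOrderOf_eq_of_ne_zero' {t : K} (h2 : (2 : K) ≠ 0) (h3 : (3 : K) ≠ 0)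
    (h7 : (7 : K) ≠ 0) (hs : c₀ (3 * t) * d (3 * t) ≠ 0) {ρ M : K}
    (hρ : ρ ^ 2 = 2 * ((3 * t) ^ 2 + 7) * ((3 * t) ^ 2 + 63))
    (hM : M ^ 2 = -264 * (3 * t) ^ 4 - 11088 * (3 * t) ^ 2 - 9408 * (3 * t) + 38808
      + 192 * ((3 * t) ^ 2 + 7) * ρ)
    (ha : 81 * t ^ 4 + 378 * t ^ 2 - 1848 * t - 147 ≠ 0) :
    ∃ P : (curve (3 * t) h2 h3 h7 hs).jacobianPoints, addOrderOf P = 48 := by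
  have h8 : (8 : K) ≠ 0 := by
    rw [show (8 : K) = 2 ^ 3 by norm_num]
    exact pow_ne_zero _ h2
  have hdt := d_three_mul h3 t
  set a : K := 81 * t ^ 4 + 378 * t ^ 2 - 1848 * t - 147 with ha'
  refine exists_addOrderOf_eq_of_tangent h2 h3 h7 hs (a := a)
    (b := -31 * (81 * t ^ 4 + 378 * t ^ 2 - 147) + 32200 * t + 16 * a - 8 * d (3 * t))
    (n := (-3 * d (3 * t) + 4 * (9 * t ^ 2 + 7) * ρ) / a) (m := M / (8 * a))
    (κ := 8) (σ := -1) (ε := -1) h8 ?_ ?_ ?_ ?_ (by norm_num) ?_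
  · rw [sextic_three_mul h3, hdt, ha']
    simp only [map_add, map_sub, map_mul, map_neg, map_pow, map_ofNat]
    ring
  · have key : d (3 * t) * M ^ 2
        = 64 * a ^ 2 - 8 * (-3 * d (3 * t) + 4 * (9 * t ^ 2 + 7) * ρ) ^ 2 := by
      rw [ha', hdt]
      linear_combination (81 * t ^ 4 + 378 * t ^ 2 + 1736 * t - 147) * hM
        + 128 * (9 * t ^ 2 + 7) ^ 2 * hρ
    refine mul_left_cancel₀ (mul_ne_zero h8 (pow_ne_zero 2 ha)) ?_
    field_simp
    linear_combination key
  · refine mul_left_cancel₀ ha ?_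
    have e : a * ((-3 * d (3 * t) + 4 * (9 * t ^ 2 + 7) * ρ) / a)
        = -3 * d (3 * t) + 4 * (9 * t ^ 2 + 7) * ρ := mul_div_cancel₀ _ ha
    generalize (-3 * d (3 * t) + 4 * (9 * t ^ 2 + 7) * ρ) / a = n at e ⊢
    have e' : a * n + 3 * d (3 * t) = 4 * (9 * t ^ 2 + 7) * ρ := by linear_combination e
    rw [hdt] at e' ⊢
    linear_combination (a * n + 3 * (81 * t ^ 4 + 378 * t ^ 2 + 1736 * t - 147)
      + 4 * (9 * t ^ 2 + 7) * ρ) * e' + 16 * (9 * t ^ 2 + 7) ^ 2 * hρ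
  · rw [sextic_three_mul h3, hdt, ha']
    simp only [map_add, map_sub, map_mul, map_neg, map_pow, map_ofNat, map_one]
    ring
  · rw [hdt, ha']
    ring

/-- The points of the elliptic curve `w² = z³ + 14z² + 196z` parametrise the `s` for which the
point of order `8` is divisible by `2`. -/
lemma exists_sq_eq {s z w : K} (hzw : w ^ 2 = z ^ 3 + 14 * z ^ 2 + 196 * z)
    (hden : z ^ 4 - 896 * z ^ 3 - 24696 * z ^ 2 - 175616 * z + 38416 ≠ 0)
    (hszw : s = -21 * (((z ^ 2 + 196) * (z ^ 2 + 56 * z + 196) + 32 * (z + 14) * (z - 14) * w) /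
      (z ^ 4 - 896 * z ^ 3 - 24696 * z ^ 2 - 175616 * z + 38416))) :
    ∃ ρ M N : K, ρ ^ 2 = 2 * (s ^ 2 + 7) * (s ^ 2 + 63) ∧
      M ^ 2 = 6 * (5 * s ^ 4 + 210 * s ^ 2 - 392 * s - 735) + 24 * (s ^ 2 + 7) * ρ ∧
      N ^ 2 = -264 * s ^ 4 - 11088 * s ^ 2 - 9408 * s + 38808 + 192 * (s ^ 2 + 7) * ρ := by
  -- `s = (E + F w) / D`, and the three square roots are sought as `(Aᵢ + Bᵢ w) / D²`.
  obtain ⟨D, hD⟩ : ∃ D, D = z ^ 4 - 896 * z ^ 3 - 24696 * z ^ 2 - 175616 * z + 38416 := ⟨_, rfl⟩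
  obtain ⟨E, hE⟩ : ∃ E, E = -21 * ((z ^ 2 + 196) * (z ^ 2 + 56 * z + 196)) := ⟨_, rfl⟩
  obtain ⟨F, hF⟩ : ∃ F, F = -21 * (32 * (z + 14) * (z - 14)) := ⟨_, rfl⟩
  rw [← hD] at hden
  have hs : s = (E + F * w) / D := by
    rw [hszw, ← hD, hE, hF]
    ring
  obtain ⟨A₁, hA₁⟩ : ∃ A₁, A₁ = 672 * z ^ 8 + 620928 * z ^ 7 + 49523712 * z ^ 6
      + 1279713792 * z ^ 5 + 19361664000 * z ^ 4
      + 250823903232 * z ^ 3 + 1902502920192 * z ^ 2 + 4675299729408 * z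
      + 991730245632 := ⟨_, rfl⟩
  obtain ⟨B₁, hB₁⟩ : ∃ B₁, B₁ = 39984 * z ^ 6 + 2107392 * z ^ 5 + 66843840 * z ^ 4
      - 13101392640 * z ^ 2 - 80957571072 * z
      - 301060967424 := ⟨_, rfl⟩
  obtain ⟨A₂, hA₂⟩ : ∃ A₂, A₂ = 3696 * z ^ 8 + 3697344 * z ^ 7 + 200597376 * z ^ 6
      + 3320986368 * z ^ 5 - 650913328128 * z ^ 3 - 7706148796416 * z ^ 2 - 27839284752384 * z - 5454516350976 := ⟨_, rfl⟩
  obtain ⟨B₂, hB₂⟩ : ∃ B₂, B₂ = 225792 * z ^ 6 + 12446784 * z ^ 5 + 132765696 * z ^ 4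
      - 77446656 * z ^ 3 + 26022076416 * z ^ 2 + 478155654144 * z + 1700108992512 := ⟨_, rfl⟩
  obtain ⟨A₃, hA₃⟩ : ∃ A₃, A₃ = 1344 * z ^ 8 + 1128960 * z ^ 7 + 133292544 * z ^ 6
      + 1165387776 * z ^ 5 - 228416004096 * z ^ 3 - 5120566370304 * z ^ 2 - 8500544962560 * z - 1983460491264 := ⟨_, rfl⟩
  obtain ⟨B₃, hB₃⟩ : ∃ B₃, B₃ = 75264 * z ^ 6 + 8297856 * z ^ 5 - 1725954048 * z ^ 4
      - 52921881600 * z ^ 3 - 338286993408 * z ^ 2 + 318770436096 * z + 566702997504 := ⟨_, rfl⟩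
  generalize hh : z ^ 3 + 14 * z ^ 2 + 196 * z = h at hzw
  refine ⟨(A₁ + B₁ * w) / D ^ 2, (A₂ + B₂ * w) / D ^ 2, (A₃ + B₃ * w) / D ^ 2, ?_, ?_, ?_⟩
  -- After replacing `w²` by `h`, the claim splits into its component `h₀` along `1` and its
  -- component `h₁` along `w`, two polynomial identities in `z`. The other two claims split in the
  -- same way.
  · have h₀ : A₁ ^ 2 + B₁ ^ 2 * h
        = 2 * E ^ 4 + 140 * E ^ 2 * D ^ 2 + 882 * D ^ 4
          + (12 * E ^ 2 * F ^ 2 + 140 * F ^ 2 * D ^ 2) * h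
          + 2 * F ^ 4 * h ^ 2 := by
      subst hA₁ hB₁ hD hE hF hh
      ring
    have h₁ : 2 * A₁ * B₁
        = 8 * E ^ 3 * F + 280 * E * F * D ^ 2
          + (8 * E * F ^ 3) * h := by
      subst hA₁ hB₁ hD hE hF hh
      ring
    rw [hs]
    field_simp
    linear_combination h₀ + w * h₁ + (B₁ ^ 2 - (12 * E ^ 2 * F ^ 2 + 140 * F ^ 2 * D ^ 2)
      - (8 * E * F ^ 3) * w - 2 * F ^ 4 * (w ^ 2 + h)) * hzw
  · have h₀ : A₂ ^ 2 + B₂ ^ 2 * h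
        = 30 * E ^ 4 + 1260 * E ^ 2 * D ^ 2 - 2352 * E * D ^ 3 - 4410 * D ^ 4 + 24 * (E ^ 2
          + 7 * D ^ 2) * A₁
          + (180 * E ^ 2 * F ^ 2 + 1260 * F ^ 2 * D ^ 2 + 24 * (F ^ 2 * A₁ + 2 * E * F * B₁)) * h
          + 30 * F ^ 4 * h ^ 2 := by
      subst hA₁ hB₁ hA₂ hB₂ hD hE hF hh
      ring
    have h₁ : 2 * A₂ * B₂
        = 120 * E ^ 3 * F + 2520 * E * F * D ^ 2 - 2352 * F * D ^ 3 + 24 * (2 * E * F * A₁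
          + (E ^ 2 + 7 * D ^ 2) * B₁)
          + (120 * E * F ^ 3 + 24 * F ^ 2 * B₁) * h := by
      subst hA₁ hB₁ hA₂ hB₂ hD hE hF hh
      ring
    rw [hs]
    field_simp
    linear_combination h₀ + w * h₁ + (B₂ ^ 2 - (180 * E ^ 2 * F ^ 2 + 1260 * F ^ 2 * D ^ 2
      + 24 * (F ^ 2 * A₁ + 2 * E * F * B₁))
      - (120 * E * F ^ 3 + 24 * F ^ 2 * B₁) * w - 30 * F ^ 4 * (w ^ 2 + h)) * hzw
  · have h₀ : A₃ ^ 2 + B₃ ^ 2 * h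
        = -264 * E ^ 4 - 11088 * E ^ 2 * D ^ 2 - 9408 * E * D ^ 3 + 38808 * D ^ 4
          + 192 * (E ^ 2 + 7 * D ^ 2) * A₁
          + (-1584 * E ^ 2 * F ^ 2 - 11088 * F ^ 2 * D ^ 2 + 192 * (F ^ 2 * A₁
          + 2 * E * F * B₁)) * h
          - 264 * F ^ 4 * h ^ 2 := by
      subst hA₁ hB₁ hA₃ hB₃ hD hE hF hh
      ring
    have h₁ : 2 * A₃ * B₃
        = -1056 * E ^ 3 * F - 22176 * E * F * D ^ 2 - 9408 * F * D ^ 3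
          + 192 * (2 * E * F * A₁ + (E ^ 2 + 7 * D ^ 2) * B₁)
          + (-1056 * E * F ^ 3 + 192 * F ^ 2 * B₁) * h := by
      subst hA₁ hB₁ hA₃ hB₃ hD hE hF hh
      ring
    rw [hs]
    field_simp
    linear_combination h₀ + w * h₁ + (B₃ ^ 2 - (-1584 * E ^ 2 * F ^ 2 - 11088 * F ^ 2 * D ^ 2
      + 192 * (F ^ 2 * A₁ + 2 * E * F * B₁))
      - (-1056 * E * F ^ 3 + 192 * F ^ 2 * B₁) * w + 264 * F ^ 4 * (w ^ 2 + h)) * hzw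

end C24

theorem theoremT {K : Type*} [Field K] (h2 : (2 : K) ≠ 0) (h3 : (3 : K) ≠ 0) (h7 : (7 : K) ≠ 0)
    (s : K) (hs : C24.c₀ s * C24.d s ≠ 0)
    (z w : K) (hzw : w ^ 2 = z ^ 3 + 14 * z ^ 2 + 196 * z)
    (hden : z ^ 4 - 896 * z ^ 3 - 24696 * z ^ 2 - 175616 * z + 38416 ≠ 0)
    (hszw : s = -21 * (((z ^ 2 + 196) * (z ^ 2 + 56 * z + 196) + 32 * (z + 14) * (z - 14) * w) /
      (z ^ 4 - 896 * z ^ 3 - 24696 * z ^ 2 - 175616 * z + 38416))) :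
    ∃ P : (C24.curve s h2 h3 h7 hs).jacobianPoints, addOrderOf P = 48 := by
  obtain ⟨ρ, M, N, hρ, hM, hN⟩ := C24.exists_sq_eq hzw hden hszw
  clear hszw
  obtain ⟨t, rfl⟩ : ∃ t, s = 3 * t := ⟨s / 3, (mul_div_cancel₀ s h3).symm⟩
  by_cases ha : 81 * t ^ 4 + 378 * t ^ 2 + 840 * t - 147 = 0
  · refine C24.exists_addOrderOf_eq_of_ne_zero' h2 h3 h7 hs hρ hN fun hb => ?_
    -- The values of `a` in the two constructions differ by `2⁷ · 7 · s`, and `s ≠ 0` because `c₀ ≠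
    -- 0`; so they do not both vanish.
    have h : (2 ^ 7 * 7 * (3 * t) : K) = 0 := by linear_combination ha - hb
    have ht : (3 * t : K) ≠ 0 := by
      intro h0
      simp [h0, C24.c₀] at hs
    exact mul_ne_zero (mul_ne_zero (pow_ne_zero _ h2) h7) ht h
  · exact C24.exists_addOrderOf_eq_of_ne_zero h2 h3 h7 hs hρ hM ha
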